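/- Let $F$ be a field, let $L=L(X)$ be the free Lie algebra over $F$ with a finite free basis $X$, and let $L=\bigoplus_{n\ge 1}L_n$ be its grading by degree in $X$, so that $L_n$ is the linear span of all commutators of length $n$ in the elements of $X$. Elements of the subspaces $L_n$ are called homogeneous, and a subalgebra of $L$ is called homogeneous if it contains all homogeneous components of each of its elements. A free basis of a subalgebra $C\subseteq L$ is a subset $S$ that generates $C$ and is independent (the natural homomorphism from the free Lie algebra on $S$ to $L$ is injective). Let $H$ be a finitely generated subalgebra of $L$. Then $H$ has a free basis, and for every free basis $B_0$ of $H$ there is a set $B\supseteq B_0$ which is a free basis of a subalgebra $C$ of finite codimension in $L$ (that is, $\dim_F L/C<\infty$) such that, with $K$ denoting the subalgebra generated by $B\setminus B_0$: 1. $C$ is the free product (the coproduct of Lie algebras) $H\ast K$; more precisely, there is an isomorphism $H\ast K\to C$ that restricts to the inclusions on $H$ and on $K$; 2. all elements of $B\setminus B_0$ are homogeneous, and $K$ is a homogeneous subalgebra; 3. if $H$ is homogeneous, then $C$ contains a term $L^t$ of the lower central series of $L$ (where $L^1=L$ and $L^{n+1}=[L,L^n]$), for some $t\ge 1$. -/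

import Mathlib

universe u v w z

noncomputable section

namespace FreeLie

/-- A set `S` of elements of a Lie algebra `L` is a free basis of the subalgebra `C` of `L` if it
generates `C` and is independent, that is, the canonical homomorphism to `L` from the free Lie
algebra on `S` is injective. -/
def IsFreeBasis {F : Type u} [Field F] {L : Type v} [LieRing L] [LieAlgebra F L]
    (S : Set L) (C : LieSubalgebra F L) : Prop :=
  Function.Injective (FreeLieAlgebra.lift F (fun s : S => (s : L))) ∧
    LieSubalgebra.lieSpan F L S = C

/-- The subalgebra `H` is generated by a finite set. -/
def IsFinitelyGenerated {F : Type u} [Field F] {L : Type v} [LieRing L] [LieAlgebra F L]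
    (H : LieSubalgebra F L) : Prop :=
  ∃ S : Set L, S.Finite ∧ LieSubalgebra.lieSpan F L S = H

/-! ### The grading of the free Lie algebra by the degree in the free generators -/

/-- `IsCommutator F X n c`: the element `c` of the free Lie algebra `L(X)` is a commutator of
length `n` in `X`. -/
inductive IsCommutator (F : Type u) [Field F] (X : Type v) : ℕ → FreeLieAlgebra F X → Prop
  | of (x : X) : IsCommutator F X 1 (FreeLieAlgebra.of F x)
  | lie {k l : ℕ} {c d : FreeLieAlgebra F X} (hc : IsCommutator F X k c)
      (hd : IsCommutator F X l d) : IsCommutator F X (k + l) ⁅c, d⁆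

/-- The homogeneous component `L_n` of `L = L(X)`, the linear span of the commutators of
length `n` in `X`. (So `L_0 = 0`.) -/
def homogeneousComponent (F : Type u) [Field F] (X : Type v) (n : ℕ) :
    Submodule F (FreeLieAlgebra F X) :=
  Submodule.span F {c | IsCommutator F X n c}

/-- A set of elements of `L(X)` is homogeneous if each of them lies in some `L_n`. -/
def IsHomogeneousSet {F : Type u} [Field F] {X : Type v} (S : Set (FreeLieAlgebra F X)) : Prop :=
  ∀ s ∈ S, ∃ n : ℕ, s ∈ homogeneousComponent F X n

/-- A subalgebra `H` of `L(X)` is homogeneous (graded) if it contains all the homogeneous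
components of each of its elements: if a finite sum `∑ a_n` with `a_n ∈ L_n` lies in `H`, then
so does every `a_n`. -/
def IsHomogeneousSubalgebra {F : Type u} [Field F] {X : Type v}
    (H : LieSubalgebra F (FreeLieAlgebra F X)) : Prop :=
  ∀ a : ℕ →₀ FreeLieAlgebra F X, (∀ n, a n ∈ homogeneousComponent F X n) →
    (a.sum fun _ y => y) ∈ H → ∀ n, a n ∈ H

/-! ### The free product of two Lie algebras -/

section FreeProduct

variable (F : Type u) [Field F] (H : Type v) [LieRing H] [LieAlgebra F H]
  (K : Type w) [LieRing K] [LieAlgebra F K]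

/-- The free generator of `L(H ⊔ K)` given by an element of the disjoint union `H ⊔ K`. -/
abbrev gen (x : H ⊕ K) : FreeLieAlgebra F (H ⊕ K) := FreeLieAlgebra.of F x

/-- The relations which make the two maps `H → L(H ⊔ K)` and `K → L(H ⊔ K)` homomorphisms. -/
inductive FreeProductRelator : FreeLieAlgebra F (H ⊕ K) → Prop
  | add_left (a b : H) : FreeProductRelator (gen F H K (.inl (a + b)) -
      (gen F H K (.inl a) + gen F H K (.inl b)))
  | smul_left (r : F) (a : H) : FreeProductRelator
      (gen F H K (.inl (r • a)) - r • gen F H K (.inl a))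
  | lie_left (a b : H) : FreeProductRelator
      (gen F H K (.inl ⁅a, b⁆) - ⁅gen F H K (.inl a), gen F H K (.inl b)⁆)
  | add_right (a b : K) : FreeProductRelator (gen F H K (.inr (a + b)) -
      (gen F H K (.inr a) + gen F H K (.inr b)))
  | smul_right (r : F) (a : K) : FreeProductRelator
      (gen F H K (.inr (r • a)) - r • gen F H K (.inr a))
  | lie_right (a b : K) : FreeProductRelator
      (gen F H K (.inr ⁅a, b⁆) - ⁅gen F H K (.inr a), gen F H K (.inr b)⁆)

/-- The ideal of `L(H ⊔ K)` generated by the relators. -/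
def freeProductIdeal : LieIdeal F (FreeLieAlgebra F (H ⊕ K)) :=
  LieSubmodule.lieSpan F (FreeLieAlgebra F (H ⊕ K)) {r | FreeProductRelator F H K r}

/-- The free product `H ∗ K` of two Lie algebras, that is, their coproduct in the category of
Lie algebras over `F` (see `FreeProduct.existsUnique_lift`). -/
abbrev FreeProduct : Type max u v w :=
  FreeLieAlgebra F (H ⊕ K) ⧸ freeProductIdeal F H K

namespace FreeProduct

variable {F H K}

theorem mk_eq_of_relator {x y : FreeLieAlgebra F (H ⊕ K)}
    (h : FreeProductRelator F H K (x - y)) :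
    (LieSubmodule.Quotient.mk x : FreeProduct F H K) = LieSubmodule.Quotient.mk y :=
  (Submodule.Quotient.eq _).mpr (LieSubmodule.subset_lieSpan h)

variable (F H K)

/-- The canonical homomorphism `H → H ∗ K`. -/
def inl : H →ₗ⁅F⁆ FreeProduct F H K where
  toFun a := LieSubmodule.Quotient.mk (FreeLieAlgebra.of F (Sum.inl a))
  map_add' a b := mk_eq_of_relator (.add_left a b)
  map_smul' r a := mk_eq_of_relator (.smul_left r a)
  map_lie' {a b} := mk_eq_of_relator (.lie_left a b)

/-- The canonical homomorphism `K → H ∗ K`. -/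
def inr : K →ₗ⁅F⁆ FreeProduct F H K where
  toFun a := LieSubmodule.Quotient.mk (FreeLieAlgebra.of F (Sum.inr a))
  map_add' a b := mk_eq_of_relator (.add_right a b)
  map_smul' r a := mk_eq_of_relator (.smul_right r a)
  map_lie' {a b} := mk_eq_of_relator (.lie_right a b)

variable {F H K}

/-- The universal property of the free product. -/
theorem existsUnique_lift {M : Type z} [LieRing M] [LieAlgebra F M]
    (f : H →ₗ⁅F⁆ M) (g : K →ₗ⁅F⁆ M) :
    ∃! φ : FreeProduct F H K →ₗ⁅F⁆ M, φ.comp (inl F H K) = f ∧ φ.comp (inr F H K) = g := by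
  let ψ : FreeLieAlgebra F (H ⊕ K) →ₗ⁅F⁆ M := FreeLieAlgebra.lift F (Sum.elim f g)
  have hψ : freeProductIdeal F H K ≤ ψ.ker := by
    refine LieSubmodule.lieSpan_le.mpr ?_
    intro r hr
    change r ∈ ψ.ker
    rw [LieHom.mem_ker]
    cases hr <;> simp [ψ]
  have hψ' : ∀ x ∈ freeProductIdeal F H K, ψ x = 0 := fun x hx => (LieHom.mem_ker).mp (hψ hx)
  let φ₀ : FreeProduct F H K →ₗ[F] M :=
    Submodule.liftQ (freeProductIdeal F H K).toSubmodule (ψ : _ →ₗ[F] M)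
      (fun x hx => LinearMap.mem_ker.mpr (hψ' x hx))
  let φ : FreeProduct F H K →ₗ⁅F⁆ M :=
    { φ₀ with
      map_lie' := by
        intro x y
        obtain ⟨x, rfl⟩ := Submodule.Quotient.mk_surjective _ x
        obtain ⟨y, rfl⟩ := Submodule.Quotient.mk_surjective _ y
        exact ψ.map_lie x y }
  have hφ : ∀ x, φ (LieSubmodule.Quotient.mk x) = ψ x := fun _ => rfl
  refine ⟨φ, ⟨?_, ?_⟩, ?_⟩
  · ext a
    exact (hφ (gen F H K (.inl a))).trans (by simp [ψ])
  · ext a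
    exact (hφ (gen F H K (.inr a))).trans (by simp [ψ])
  · rintro χ ⟨h1, h2⟩
    let q : FreeLieAlgebra F (H ⊕ K) →ₗ⁅F⁆ FreeProduct F H K :=
      { toFun := LieSubmodule.Quotient.mk
        map_add' := fun _ _ => rfl
        map_smul' := fun _ _ => rfl
        map_lie' := rfl }
    have key : χ.comp q = ψ := by
      apply FreeLieAlgebra.hom_ext
      rintro (a | a)
      · exact (LieHom.congr_fun h1 a).trans (by simp [ψ])
      · exact (LieHom.congr_fun h2 a).trans (by simp [ψ])
    ext x
    obtain ⟨x, rfl⟩ := Submodule.Quotient.mk_surjective _ x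
    exact LieHom.congr_fun key x

end FreeProduct

end FreeProduct

end FreeLie

end

/-! Order `L` by degree and let `G` be the span of the leading terms of elements of `H`
(`leadingSubalgebra`), a homogeneous subalgebra. Let `n` bound the degrees of the generators of `H`.

`G` sits in a subalgebra `M` that agrees with `G` in degrees at most `n`, contains everything of
large degree, and has a homogeneous free basis `Y` (`exists_free_enlargement`). It is reached from
`L` by finitely many steps of codimension one: pass to the kernel of a functional vanishing on
commutators. Lazard elimination (`eliminate_injective`, `mem_lieSpan_eliminate_iff`) gives an
explicit homogeneous free basis of each kernel.

Now replace each `y ∈ Y` of degree at most `n` by an element of `H` with leading term `y`, and keep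
the others. The new family is independent because its leading terms are
(`lift_injective_of_leading`). Its modified members generate `H`, since the generators of `H` can be
reduced degree by degree. It spans a subalgebra of finite codimension, since the leading terms fill
all large degrees (`exists_basis_extension`).

Finally, for free bases of `H` and of `K`, independence of the joint family is equivalent to
injectivity of `H ∗ K → L`. This second condition mentions no basis, so the basis of `H` just found
may be exchanged for any given `B₀`. -/

noncomputable section
namespace FreeLie

open scoped TensorProduct

/-! ### Generation of free Lie algebras and of their images -/

section Generation

variable {F : Type u} [Field F] {ι : Type v}

theorem lieSpan_range_of : LieSubalgebra.lieSpan F (FreeLieAlgebra F ι)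
    (Set.range (FreeLieAlgebra.of F)) = ⊤ := by
  set S := LieSubalgebra.lieSpan F (FreeLieAlgebra F ι) (Set.range (FreeLieAlgebra.of F))
  let g : FreeLieAlgebra F ι →ₗ⁅F⁆ S := FreeLieAlgebra.lift F fun i =>
    ⟨FreeLieAlgebra.of F i, LieSubalgebra.subset_lieSpan ⟨i, rfl⟩⟩
  have hg : S.incl.comp g = LieHom.id := by
    apply FreeLieAlgebra.hom_ext
    intro i
    simp [g]
  rw [eq_top_iff]
  intro a _
  have h := LieHom.congr_fun hg a
  rw [LieHom.comp_apply, LieHom.id_apply] at h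
  rw [← h]
  exact (g a).2

theorem freeLie_induction {p : FreeLieAlgebra F ι → Prop} (a : FreeLieAlgebra F ι)
    (of : ∀ i, p (FreeLieAlgebra.of F i)) (zero : p 0)
    (add : ∀ a b, p a → p b → p (a + b)) (smul : ∀ (r : F) a, p a → p (r • a))
    (lie : ∀ a b, p a → p b → p ⁅a, b⁆) : p a := by
  have ha : a ∈ LieSubalgebra.lieSpan F (FreeLieAlgebra F ι)
      (Set.range (FreeLieAlgebra.of F)) := by
    rw [lieSpan_range_of]; trivial
  refine LieSubalgebra.lieSpan_induction (p := fun x _ => p x) F ?_ zero ?_ ?_ ?_ ha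
  · rintro _ ⟨i, rfl⟩
    exact of i
  · exact fun a b _ _ => add a b
  · exact fun r a _ => smul r a
  · exact fun a b _ _ => lie a b

variable {L : Type w} [LieRing L] [LieAlgebra F L]

theorem range_lift (f : ι → L) :
    (FreeLieAlgebra.lift F f).range = LieSubalgebra.lieSpan F L (Set.range f) := by
  rw [LieHom.range_eq_map, ← lieSpan_range_of, LieSubalgebra.map_lieSpan, ← Set.range_comp]
  congr 2
  exact FreeLieAlgebra.of_comp_lift f

theorem mem_lieSpan_range_iff (f : ι → L) (x : L) :
    x ∈ LieSubalgebra.lieSpan F L (Set.range f) ↔ ∃ a, FreeLieAlgebra.lift F f a = x := by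
  rw [← range_lift, LieHom.mem_range]

theorem comp_lift {M : Type z} [LieRing M] [LieAlgebra F M] (g : L →ₗ⁅F⁆ M) (f : ι → L) :
    g.comp (FreeLieAlgebra.lift F f) = FreeLieAlgebra.lift F (fun i => g (f i)) := by
  apply FreeLieAlgebra.hom_ext
  simp

end Generation

/-! ### Coefficients in `L[t]` -/

section Polynomial

variable {F : Type u} [Field F] {L : Type w} [LieRing L] [LieAlgebra F L]

/-- The `n`-th coefficient of an element of `L[t]`. -/
def lieCoeff (F : Type u) [Field F] (L : Type w) [LieRing L] [LieAlgebra F L] (n : ℕ) :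
    Polynomial F ⊗[F] L →ₗ[F] L :=
  TensorProduct.lid F L ∘ₗ (Polynomial.lcoeff F n).rTensor L

@[simp]
theorem lieCoeff_tmul (n : ℕ) (p : Polynomial F) (a : L) :
    lieCoeff F L n (p ⊗ₜ a) = p.coeff n • a := by
  simp [lieCoeff]

theorem lieCoeff_lie (n : ℕ) (p q : Polynomial F ⊗[F] L) :
    lieCoeff F L n ⁅p, q⁆ =
      ∑ ij ∈ Finset.HasAntidiagonal.antidiagonal n, ⁅lieCoeff F L ij.1 p, lieCoeff F L ij.2 q⁆ := by
  induction p using TensorProduct.induction_on with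
  | zero =>
    have h : ⁅(0 : Polynomial F ⊗[F] L), q⁆ = 0 := zero_lie q
    simp [h]
  | add p p' hp hp' =>
    have h : ⁅p + p', q⁆ = ⁅p, q⁆ + ⁅p', q⁆ := add_lie p p' q
    simp [h, hp, hp', Finset.sum_add_distrib]
  | tmul p a =>
    induction q using TensorProduct.induction_on with
    | zero =>
      have h : ⁅p ⊗ₜ[F] a, (0 : Polynomial F ⊗[F] L)⁆ = 0 := lie_zero (L := Polynomial F ⊗[F] L) _
      simp [h]
    | add q q' hq hq' =>
      have h : ⁅p ⊗ₜ[F] a, q + q'⁆ = ⁅p ⊗ₜ[F] a, q⁆ + ⁅p ⊗ₜ[F] a, q'⁆ :=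
        lie_add (L := Polynomial F ⊗[F] L) _ q q'
      simp [h, hq, hq', Finset.sum_add_distrib]
    | tmul q b =>
      simp [LieAlgebra.ExtendScalars.bracket_tmul, Polynomial.coeff_mul, Finset.sum_smul,
        smul_smul, mul_comm]

end Polynomial

/-! ### Derivations of a free Lie algebra -/

section Derivation

variable {F : Type u} [Field F] {ι : Type v}

/-- A derivation of the free Lie algebra with arbitrary values on the free generators. -/
theorem exists_derivation (f : ι → FreeLieAlgebra F ι) :
    ∃ D : LieDerivation F (FreeLieAlgebra F ι) (FreeLieAlgebra F ι),
      ∀ i, D (FreeLieAlgebra.of F i) = f i := by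
  -- The deformation `x ↦ x + t f(x)` is a homomorphism whose constant coefficient is the identity,
  -- so its coefficient of `t` satisfies the Leibniz rule.
  let γ : FreeLieAlgebra F ι →ₗ⁅F⁆ Polynomial F ⊗[F] FreeLieAlgebra F ι :=
    FreeLieAlgebra.lift F fun i =>
      (1 : Polynomial F) ⊗ₜ FreeLieAlgebra.of F i + (Polynomial.X : Polynomial F) ⊗ₜ f i
  have h0 : ∀ a, lieCoeff F _ 0 (γ a) = a := by
    intro a
    induction a using freeLie_induction with
    | of i => simp [γ]
    | zero => simp
    | add a b ha hb => simp [ha, hb]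
    | smul r a ha => simp [ha]
    | lie a b ha hb => simp [lieCoeff_lie, ha, hb]
  refine ⟨{ toLinearMap := lieCoeff F _ 1 ∘ₗ (γ : _ →ₗ[F] _), leibniz' := ?_ }, ?_⟩
  · intro a b
    simp only [LinearMap.comp_apply, LieHom.coe_toLinearMap, LieHom.map_lie, lieCoeff_lie]
    rw [Finset.Nat.antidiagonal_succ]
    simp [h0]
    rw [← lie_skew b]
    abel
  · intro i
    simp [γ, Polynomial.coeff_one]

end Derivation

/-! ### Lazard elimination -/

section Elimination

variable {F : Type u} [Field F] {ι : Type v} {L : Type w} [LieRing L] [LieAlgebra F L]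

/-- The elements `ad(x)^k (y - c_y x)`, `y ≠ x`, obtained from a family by eliminating one of
its members `x`. -/
def eliminate (v : ι → L) (c : ι → F) (x : ι) (p : ℕ × {i : ι // i ≠ x}) : L :=
  (fun a => ⁅v x, a⁆)^[p.1] (v p.2 - c p.2 • v x)

theorem eliminate_zero (v : ι → L) (c : ι → F) (x : ι) (i : {i : ι // i ≠ x}) :
    eliminate v c x (0, i) = v i - c i • v x := rfl

theorem eliminate_succ (v : ι → L) (c : ι → F) (x : ι) (k : ℕ) (i : {i : ι // i ≠ x}) :
    eliminate v c x (k + 1, i) = ⁅v x, eliminate v c x (k, i)⁆ := by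
  simp only [eliminate, Function.iterate_succ_apply']

theorem map_eliminate {M : Type z} [LieRing M] [LieAlgebra F M] (g : L →ₗ⁅F⁆ M) (v : ι → L)
    (c : ι → F) (x : ι) (p : ℕ × {i : ι // i ≠ x}) :
    g (eliminate v c x p) = eliminate (fun i => g (v i)) c x p := by
  obtain ⟨k, i⟩ := p
  induction k with
  | zero => simp [eliminate_zero]
  | succ k ih => simp [eliminate_succ, ih]

/-- Let `D` be the derivation of the free algebra on symbols `(k, i)` that shifts `k` to `k + 1`. In
the semidirect product with the derivations, send `x` to `D` and any other `i` to `(0, i) + c i •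
D`. Then `ad(x)^k (i - c i • x)` goes to the symbol `(k, i)`, so the eliminated elements are
independent. -/
theorem eliminate_of_injective (c : ι → F) (x : ι) :
    Function.Injective (FreeLieAlgebra.lift F (eliminate (FreeLieAlgebra.of F) c x)) := by
  classical
  obtain ⟨D, hD⟩ := exists_derivation (F := F) fun p : ℕ × {i : ι // i ≠ x} =>
    FreeLieAlgebra.of F (p.1 + 1, p.2)
  let ψ : LieDerivation F (FreeLieAlgebra F (ℕ × {i : ι // i ≠ x}))
      (FreeLieAlgebra F (ℕ × {i : ι // i ≠ x})) →ₗ⁅F⁆ _ := LieHom.id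
  let g : ι → LieAlgebra.SemiDirectSum (FreeLieAlgebra F (ℕ × {i : ι // i ≠ x})) _ ψ := fun i =>
    if h : i = x then ⟨0, D⟩ else ⟨FreeLieAlgebra.of F (0, ⟨i, h⟩), c i • D⟩
  let θ := FreeLieAlgebra.lift F g
  have hgx : g x = ⟨0, D⟩ := by simp [g]
  have hθ : ∀ p, θ (eliminate (FreeLieAlgebra.of F) c x p) =
      LieAlgebra.SemiDirectSum.inl ψ (FreeLieAlgebra.of F p) := by
    rintro ⟨k, i⟩
    rw [map_eliminate]
    simp only [θ, FreeLieAlgebra.lift_of_apply]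
    induction k with
    | zero =>
      rw [eliminate_zero, hgx]
      simp [g, i.2]
    | succ k ih =>
      rw [eliminate_succ, ih, hgx]
      simp [ψ, hD]
  have hc : θ.comp (FreeLieAlgebra.lift F (eliminate (FreeLieAlgebra.of F) c x)) =
      LieAlgebra.SemiDirectSum.inl ψ := by
    apply FreeLieAlgebra.hom_ext
    intro p
    simp only [LieHom.comp_apply, FreeLieAlgebra.lift_of_apply, hθ]
  intro a b hab
  apply LieAlgebra.SemiDirectSum.inl_injective ψ
  rw [← hc, LieHom.comp_apply, LieHom.comp_apply, hab]

theorem eliminate_injective {v : ι → L} (hv : Function.Injective (FreeLieAlgebra.lift F v))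
    (c : ι → F) (x : ι) :
    Function.Injective (FreeLieAlgebra.lift F (eliminate v c x)) := by
  have h : FreeLieAlgebra.lift F (eliminate v c x) = (FreeLieAlgebra.lift F v).comp
      (FreeLieAlgebra.lift F (eliminate (FreeLieAlgebra.of F) c x)) := by
    apply FreeLieAlgebra.hom_ext
    intro p
    simp [map_eliminate]
  rw [h]
  exact hv.comp (eliminate_of_injective c x)

theorem lie_mem_lieSpan_eliminate (v : ι → L) (c : ι → F) (x : ι) {a : L}
    (ha : a ∈ LieSubalgebra.lieSpan F L (Set.range (eliminate v c x))) :
    ⁅v x, a⁆ ∈ LieSubalgebra.lieSpan F L (Set.range (eliminate v c x)) := by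
  induction ha using LieSubalgebra.lieSpan_induction with
  | mem a h =>
    obtain ⟨⟨k, i⟩, rfl⟩ := h
    rw [← eliminate_succ]
    exact LieSubalgebra.subset_lieSpan ⟨_, rfl⟩
  | zero => simp
  | add a b _ _ ha hb => rw [lie_add]; exact add_mem ha hb
  | smul r a _ ha => rw [lie_smul]; exact LieSubalgebra.smul_mem _ _ ha
  | lie a b h h' ha hb =>
    rw [leibniz_lie]
    exact add_mem (LieSubalgebra.lie_mem _ ha h') (LieSubalgebra.lie_mem _ h hb)

/-- The subalgebra of the eliminated elements is stable under `ad (v x)`, so adding the line through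
`v x` already gives a subalgebra containing every `v i`. -/
theorem exists_eq_smul_add (v : ι → L) (c : ι → F) (x : ι) (hx : c x = 1) {a : L}
    (ha : a ∈ LieSubalgebra.lieSpan F L (Set.range v)) :
    ∃ (r : F), ∃ b ∈ LieSubalgebra.lieSpan F L (Set.range (eliminate v c x)),
      a = r • v x + b := by
  induction ha using LieSubalgebra.lieSpan_induction with
  | mem a h =>
    obtain ⟨i, rfl⟩ := h
    by_cases hi : i = x
    · subst hi
      exact ⟨1, 0, zero_mem _, by simp⟩
    · exact ⟨c i, _, LieSubalgebra.subset_lieSpan ⟨(0, ⟨i, hi⟩), rfl⟩, by simp [eliminate_zero]⟩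
  | zero => exact ⟨0, 0, zero_mem _, by simp⟩
  | add a b _ _ ha hb =>
    obtain ⟨r, a', ha', rfl⟩ := ha
    obtain ⟨s, b', hb', rfl⟩ := hb
    exact ⟨r + s, _, add_mem ha' hb', by rw [add_smul]; abel⟩
  | smul r a _ ha =>
    obtain ⟨s, a', ha', rfl⟩ := ha
    exact ⟨r * s, _, LieSubalgebra.smul_mem _ r ha', by rw [smul_add, smul_smul]⟩
  | lie a b _ _ ha hb =>
    obtain ⟨r, a', ha', rfl⟩ := ha
    obtain ⟨s, b', hb', rfl⟩ := hb
    refine ⟨0, r • ⁅v x, b'⁆ - s • ⁅v x, a'⁆ + ⁅a', b'⁆, add_mem (sub_mem ?_ ?_) ?_, ?_⟩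
    · exact LieSubalgebra.smul_mem _ _ (lie_mem_lieSpan_eliminate v c x hb')
    · exact LieSubalgebra.smul_mem _ _ (lie_mem_lieSpan_eliminate v c x ha')
    · exact LieSubalgebra.lie_mem _ ha' hb'
    · simp only [add_lie, lie_add, smul_lie, lie_smul, lie_self, ← lie_skew (v x) a', smul_neg]
      simp
      abel

theorem lieSpan_eliminate_le (v : ι → L) (c : ι → F) (x : ι) :
    LieSubalgebra.lieSpan F L (Set.range (eliminate v c x)) ≤
      LieSubalgebra.lieSpan F L (Set.range v) := by
  rw [LieSubalgebra.lieSpan_le]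
  rintro _ ⟨⟨k, i⟩, rfl⟩
  have h (j : ι) : v j ∈ LieSubalgebra.lieSpan F L (Set.range v) :=
    LieSubalgebra.subset_lieSpan ⟨j, rfl⟩
  induction k with
  | zero => exact sub_mem (h _) (LieSubalgebra.smul_mem _ _ (h _))
  | succ k ih =>
    rw [eliminate_succ]
    exact LieSubalgebra.lie_mem _ (h _) ih

/-- Elimination: the kernel in `⟨v⟩` of a functional `f` which vanishes on all commutators. -/
theorem mem_lieSpan_eliminate_iff (v : ι → L) (f : L →ₗ[F] F) (x : ι) (hx : f (v x) ≠ 0)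
    (hf : ∀ a ∈ LieSubalgebra.lieSpan F L (Set.range v),
      ∀ b ∈ LieSubalgebra.lieSpan F L (Set.range v), f ⁅a, b⁆ = 0) (a : L) :
    a ∈ LieSubalgebra.lieSpan F L
        (Set.range (eliminate v (fun i => f (v i) / f (v x)) x)) ↔
      a ∈ LieSubalgebra.lieSpan F L (Set.range v) ∧ f a = 0 := by
  have hker : ∀ b ∈ LieSubalgebra.lieSpan F L
      (Set.range (eliminate v (fun i => f (v i) / f (v x)) x)), f b = 0 := by
    intro b hb
    induction hb using LieSubalgebra.lieSpan_induction with
    | mem b h =>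
      obtain ⟨⟨k, i⟩, rfl⟩ := h
      cases k with
      | zero => simp [eliminate_zero, hx]
      | succ k =>
        rw [eliminate_succ]
        exact hf _ (LieSubalgebra.subset_lieSpan ⟨_, rfl⟩) _
          (lieSpan_eliminate_le _ _ _ (LieSubalgebra.subset_lieSpan ⟨_, rfl⟩))
    | zero => simp
    | add a b _ _ ha hb => simp [ha, hb]
    | smul r a _ ha => simp [ha]
    | lie a b h h' _ _ =>
      exact hf _ (lieSpan_eliminate_le _ _ _ h) _ (lieSpan_eliminate_le _ _ _ h')
  refine ⟨fun h => ⟨lieSpan_eliminate_le _ _ _ h, hker a h⟩, ?_⟩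
  rintro ⟨ha, hfa⟩
  -- Since `f b = 0`, the value of `f` on `r • v x + b` is `r * f (v x)`, which forces `r = 0`.
  obtain ⟨r, b, hb, rfl⟩ := exists_eq_smul_add v (fun i => f (v i) / f (v x)) x
    (div_self hx) ha
  have hr : r = 0 := by simpa [hker b hb, hx] using hfa
  simpa [hr] using hb

end Elimination

/-! ### Gradings by weights of the generators, and leading terms -/

section Weight

variable {F : Type u} [Field F] {ι : Type v}

/-- The homomorphism `L(ι) → L(ι)[t]` which multiplies a generator of weight `n` by `t ^ n`. -/
def weightHom (F : Type u) [Field F] {ι : Type v} (d : ι → ℕ) :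
    FreeLieAlgebra F ι →ₗ⁅F⁆ Polynomial F ⊗[F] FreeLieAlgebra F ι :=
  FreeLieAlgebra.lift F fun i => (Polynomial.X ^ d i : Polynomial F) ⊗ₜ FreeLieAlgebra.of F i

/-- The component of weight `n` of an element of a free Lie algebra with weighted generators. -/
def weightComp (F : Type u) [Field F] {ι : Type v} (d : ι → ℕ) (n : ℕ) :
    FreeLieAlgebra F ι →ₗ[F] FreeLieAlgebra F ι :=
  lieCoeff F _ n ∘ₗ (weightHom F d : _ →ₗ[F] _)

theorem weightComp_lie (d : ι → ℕ) (n : ℕ) (a b : FreeLieAlgebra F ι) :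
    weightComp F d n ⁅a, b⁆ = ∑ ij ∈ Finset.HasAntidiagonal.antidiagonal n,
      ⁅weightComp F d ij.1 a, weightComp F d ij.2 b⁆ := by
  simp [weightComp, lieCoeff_lie]

theorem weightComp_of (d : ι → ℕ) (n : ℕ) (i : ι) :
    weightComp F d n (FreeLieAlgebra.of F i) = if n = d i then FreeLieAlgebra.of F i else 0 := by
  simp [weightComp, weightHom, Polynomial.coeff_X_pow]

/-- The elements of weight `n`. -/
def weightSpace (F : Type u) [Field F] {ι : Type v} (d : ι → ℕ) (n : ℕ) :
    Submodule F (FreeLieAlgebra F ι) where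
  carrier := {a | weightHom F d a = (Polynomial.X ^ n : Polynomial F) ⊗ₜ a}
  zero_mem' := by simp
  add_mem' ha hb := by
    simp only [Set.mem_ofPred_eq] at *
    simp [ha, hb, TensorProduct.tmul_add]
  smul_mem' r a ha := by
    simp only [Set.mem_ofPred_eq] at *
    simp [ha]

theorem mem_weightSpace {d : ι → ℕ} {n : ℕ} {a : FreeLieAlgebra F ι} :
    a ∈ weightSpace F d n ↔ weightHom F d a = (Polynomial.X ^ n : Polynomial F) ⊗ₜ a := Iff.rfl

theorem of_mem_weightSpace (d : ι → ℕ) (i : ι) :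
    FreeLieAlgebra.of F i ∈ weightSpace F d (d i) := by
  simp [mem_weightSpace, weightHom]

theorem lie_mem_weightSpace {d : ι → ℕ} {m n : ℕ} {a b : FreeLieAlgebra F ι}
    (ha : a ∈ weightSpace F d m) (hb : b ∈ weightSpace F d n) :
    ⁅a, b⁆ ∈ weightSpace F d (m + n) := by
  rw [mem_weightSpace] at *
  rw [LieHom.map_lie, ha, hb, pow_add]
  exact LieAlgebra.ExtendScalars.bracket_tmul ..

theorem weightComp_of_mem {d : ι → ℕ} {n : ℕ} {a : FreeLieAlgebra F ι}
    (ha : a ∈ weightSpace F d n) (m : ℕ) : weightComp F d m a = if m = n then a else 0 := by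
  rw [mem_weightSpace] at ha
  simp [weightComp, ha, Polynomial.coeff_X_pow]

/-- The sum of the `P n` is closed under brackets and contains the generators. -/
theorem iSup_eq_top_of_lie {P : ℕ → Submodule F (FreeLieAlgebra F ι)}
    (hof : ∀ i, ∃ n, FreeLieAlgebra.of F i ∈ P n)
    (hlie : ∀ m n, ∀ a ∈ P m, ∀ b ∈ P n, ⁅a, b⁆ ∈ P (m + n)) : ⨆ n, P n = ⊤ := by
  rw [eq_top_iff]
  rintro a -
  induction a using freeLie_induction with
  | of i =>
    obtain ⟨n, hn⟩ := hof i
    exact Submodule.mem_iSup_of_mem n hn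
  | zero => exact zero_mem _
  | add a b ha hb => exact add_mem ha hb
  | smul r a ha => exact Submodule.smul_mem _ r ha
  | lie a b ha hb =>
    induction ha using Submodule.iSup_induction' with
    | zero => simp
    | add a a' _ _ h h' => rw [add_lie]; exact add_mem h h'
    | mem m a ha =>
      induction hb using Submodule.iSup_induction' with
      | zero => simp
      | add a a' _ _ h h' => rw [lie_add]; exact add_mem h h'
      | mem n b hb => exact Submodule.mem_iSup_of_mem (m + n) (hlie m n a ha b hb)

theorem iSup_weightSpace (d : ι → ℕ) : ⨆ n, weightSpace F d n = ⊤ :=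
  iSup_eq_top_of_lie (fun i => ⟨_, of_mem_weightSpace d i⟩)
    fun _ _ _ ha _ hb => lie_mem_weightSpace ha hb

theorem weight_induction (d : ι → ℕ) {p : FreeLieAlgebra F ι → Prop} (a : FreeLieAlgebra F ι)
    (mem : ∀ n, ∀ a ∈ weightSpace F d n, p a) (zero : p 0)
    (add : ∀ a b, p a → p b → p (a + b)) : p a := by
  have ha : a ∈ ⨆ n, weightSpace F d n := by rw [iSup_weightSpace]; trivial
  exact Submodule.iSup_induction (weightSpace F d) (motive := p) ha mem zero add

theorem weightComp_mem (d : ι → ℕ) (n : ℕ) (a : FreeLieAlgebra F ι) :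
    weightComp F d n a ∈ weightSpace F d n := by
  induction a using weight_induction d with
  | mem m a ha =>
    rw [weightComp_of_mem ha]
    split_ifs with h
    · rwa [h]
    · exact zero_mem _
  | zero => simp
  | add a b ha hb => rw [map_add]; exact add_mem ha hb

theorem weightComp_weightComp (d : ι → ℕ) (m n : ℕ) (a : FreeLieAlgebra F ι) :
    weightComp F d m (weightComp F d n a) = if m = n then weightComp F d n a else 0 :=
  weightComp_of_mem (weightComp_mem d n a) m

theorem sum_weightComp (d : ι → ℕ) (a : FreeLieAlgebra F ι) :
    ∃ N, ∀ n, N ≤ n → a = ∑ k ∈ Finset.range n, weightComp F d k a := by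
  induction a using weight_induction d with
  | mem m a ha =>
    refine ⟨m + 1, fun n hn => ?_⟩
    simp only [weightComp_of_mem ha]
    simp [Nat.lt_of_succ_le hn]
  | zero => exact ⟨0, by simp⟩
  | add a b ha hb =>
    obtain ⟨N, hN⟩ := ha
    obtain ⟨N', hN'⟩ := hb
    refine ⟨max N N', fun n hn => ?_⟩
    simp only [map_add, Finset.sum_add_distrib]
    rw [← hN n (le_trans (le_max_left _ _) hn), ← hN' n (le_trans (le_max_right _ _) hn)]

theorem eq_zero_of_weightComp {d : ι → ℕ} {a : FreeLieAlgebra F ι}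
    (h : ∀ n, weightComp F d n a = 0) : a = 0 := by
  obtain ⟨N, hN⟩ := sum_weightComp d a
  rw [hN N le_rfl]
  simp [h]

/-- The elements all of whose components are of weight at most `n`. -/
def weightLE (F : Type u) [Field F] {ι : Type v} (d : ι → ℕ) (n : ℕ) :
    Submodule F (FreeLieAlgebra F ι) :=
  ⨅ (k : ℕ) (_ : n < k), LinearMap.ker (weightComp F d k)

theorem mem_weightLE {d : ι → ℕ} {n : ℕ} {a : FreeLieAlgebra F ι} :
    a ∈ weightLE F d n ↔ ∀ k, n < k → weightComp F d k a = 0 := by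
  simp [weightLE]

theorem weightLE_mono (d : ι → ℕ) {m n : ℕ} (h : m ≤ n) : weightLE F d m ≤ weightLE F d n :=
  fun _ ha => mem_weightLE.mpr fun k hk => mem_weightLE.mp ha k (h.trans_lt hk)

theorem weightSpace_le_weightLE (d : ι → ℕ) (n : ℕ) : weightSpace F d n ≤ weightLE F d n := by
  intro a ha
  rw [mem_weightLE]
  intro k hk
  rw [weightComp_of_mem ha, if_neg hk.ne']

theorem exists_mem_weightLE (d : ι → ℕ) (a : FreeLieAlgebra F ι) : ∃ n, a ∈ weightLE F d n := by
  obtain ⟨N, hN⟩ := sum_weightComp d a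
  refine ⟨N, mem_weightLE.mpr fun k hk => ?_⟩
  rw [hN N le_rfl, map_sum]
  refine Finset.sum_eq_zero fun j hj => ?_
  rw [weightComp_weightComp, if_neg]
  have := Finset.mem_range.mp hj
  omega

theorem lie_mem_weightLE {d : ι → ℕ} {m n : ℕ} {a b : FreeLieAlgebra F ι}
    (ha : a ∈ weightLE F d m) (hb : b ∈ weightLE F d n) :
    ⁅a, b⁆ ∈ weightLE F d (m + n) ∧
      weightComp F d (m + n) ⁅a, b⁆ = ⁅weightComp F d m a, weightComp F d n b⁆ := by
  rw [mem_weightLE] at *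
  constructor
  · intro k hk
    rw [weightComp_lie]
    refine Finset.sum_eq_zero fun ij hij => ?_
    have hij := Finset.HasAntidiagonal.mem_antidiagonal.mp hij
    rcases lt_or_ge m ij.1 with h | h
    · rw [ha _ h, zero_lie]
    · rw [hb _ (by omega), lie_zero]
  · rw [weightComp_lie, Finset.sum_eq_single (m, n)]
    · intro ij hij hne
      have hij := Finset.HasAntidiagonal.mem_antidiagonal.mp hij
      rcases lt_or_ge m ij.1 with h | h
      · rw [ha _ h, zero_lie]
      · rw [hb _, lie_zero]
        by_contra h'
        exact hne (Prod.ext (by simp; omega) (by simp; omega))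
    · simp

theorem weightLE_pred {d : ι → ℕ} {n : ℕ} {a : FreeLieAlgebra F ι} (ha : a ∈ weightLE F d (n + 1))
    (h : weightComp F d (n + 1) a = 0) : a ∈ weightLE F d n := by
  rw [mem_weightLE] at *
  intro k hk
  rcases (Nat.succ_le_of_lt hk).eq_or_lt with rfl | h'
  · exact h
  · exact ha k h'

theorem eq_zero_of_mem_weightLE_zero {d : ι → ℕ} {a : FreeLieAlgebra F ι}
    (ha : a ∈ weightLE F d 0) (h : weightComp F d 0 a = 0) : a = 0 :=
  eq_zero_of_weightComp (d := d) fun n => by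
    rcases Nat.eq_zero_or_pos n with rfl | hn
    · exact h
    · exact mem_weightLE.mp ha n hn

theorem weightComp_zero {d : ι → ℕ} (hd : ∀ i, 0 < d i) (a : FreeLieAlgebra F ι) :
    weightComp F d 0 a = 0 := by
  induction a using freeLie_induction with
  | of i => rw [weightComp_of, if_neg (hd i).ne]
  | zero => simp
  | add a b ha hb => simp [ha, hb]
  | smul r a ha => simp [ha]
  | lie a b ha hb => simp [weightComp_lie, ha]

/-- An element of weight `n` is a combination of commutators in generators of weight at most
`n`. -/
theorem weightSpace_le_lieSpan (d : ι → ℕ) {n k : ℕ} (hk : k ≤ n) {a : FreeLieAlgebra F ι}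
    (ha : a ∈ weightSpace F d k) :
    a ∈ LieSubalgebra.lieSpan F (FreeLieAlgebra F ι) (FreeLieAlgebra.of F '' {i | d i ≤ n}) := by
  have key : ∀ k ≤ n, weightComp F d k a ∈ LieSubalgebra.lieSpan F (FreeLieAlgebra F ι)
      (FreeLieAlgebra.of F '' {i | d i ≤ n}) := by
    clear ha
    induction a using freeLie_induction with
    | of i =>
      intro k hk
      rw [weightComp_of]
      split_ifs with h
      · exact LieSubalgebra.subset_lieSpan ⟨i, by simpa [← h] using hk, rfl⟩
      · exact zero_mem _
    | zero => simp
    | add a b ha hb => intro k hk; rw [map_add]; exact add_mem (ha k hk) (hb k hk)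
    | smul r a ha => intro k hk; rw [map_smul]; exact LieSubalgebra.smul_mem _ _ (ha k hk)
    | lie a b ha hb =>
      intro k hk
      rw [weightComp_lie]
      refine sum_mem fun ij hij => ?_
      have hij := Finset.HasAntidiagonal.mem_antidiagonal.mp hij
      exact LieSubalgebra.lie_mem _ (ha _ (by omega)) (hb _ (by omega))
  simpa [weightComp_of_mem ha] using key k hk

/-- A homomorphism of free Lie algebras which maps the generators to elements of the same
weight. -/
theorem weightComp_lift {κ : Type w} {d : ι → ℕ} {e : κ → ℕ} {f : ι → FreeLieAlgebra F κ}
    (hf : ∀ i, f i ∈ weightSpace F e (d i)) (n : ℕ) (a : FreeLieAlgebra F ι) :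
    weightComp F e n (FreeLieAlgebra.lift F f a) =
      FreeLieAlgebra.lift F f (weightComp F d n a) := by
  induction a using freeLie_induction generalizing n with
  | of i =>
    rw [FreeLieAlgebra.lift_of_apply, weightComp_of_mem (hf i), weightComp_of]
    split_ifs <;> simp
  | zero => simp
  | add a b ha hb => simp [ha, hb]
  | smul r a ha => simp [ha]
  | lie a b ha hb => simp [weightComp_lie, ha, hb]

/-- Terms of top weight multiply, so the weight `n` part of a weight `n` expression in the `g i` is
the same expression in their top parts `f i`. That part may vanish; independence of `f` is what
excludes this. -/
theorem lift_mem_weightLE {κ : Type w} {d : ι → ℕ} {e : κ → ℕ} {f g : ι → FreeLieAlgebra F κ}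
    (hg : ∀ i, g i ∈ weightLE F e (d i)) (hfg : ∀ i, weightComp F e (d i) (g i) = f i)
    {n : ℕ} {a : FreeLieAlgebra F ι} (ha : a ∈ weightSpace F d n) :
    FreeLieAlgebra.lift F g a ∈ weightLE F e n ∧
      weightComp F e n (FreeLieAlgebra.lift F g a) = FreeLieAlgebra.lift F f a := by
  have key : ∀ n, FreeLieAlgebra.lift F g (weightComp F d n a) ∈ weightLE F e n ∧
      weightComp F e n (FreeLieAlgebra.lift F g (weightComp F d n a)) =
        FreeLieAlgebra.lift F f (weightComp F d n a) := by
    clear ha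
    induction a using freeLie_induction with
    | of i =>
      intro n
      rw [weightComp_of]
      split_ifs with h
      · subst h
        simpa using ⟨hg i, hfg i⟩
      · simp
    | zero => simp
    | add a b ha hb =>
      intro n
      simp only [map_add]
      exact ⟨add_mem (ha n).1 (hb n).1, by rw [(ha n).2, (hb n).2]⟩
    | smul r a ha =>
      intro n
      simp only [map_smul]
      exact ⟨Submodule.smul_mem _ _ (ha n).1, by rw [(ha n).2]⟩
    | lie a b ha hb =>
      intro n
      simp only [weightComp_lie, map_sum, LieHom.map_lie]
      refine ⟨sum_mem fun ij hij => ?_, Finset.sum_congr rfl fun ij hij => ?_⟩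
      all_goals
        rw [Finset.HasAntidiagonal.mem_antidiagonal] at hij
        have h := lie_mem_weightLE (ha ij.1).1 (hb ij.2).1
        rw [hij] at h
      · exact h.1
      · rw [← weightComp_lie, h.2, (ha _).2, (hb _).2]
  simpa [weightComp_of_mem ha] using key n

/-- If the leading terms of a family are independent then so is the family. -/
theorem lift_injective_of_leading {κ : Type w} {d : ι → ℕ} {e : κ → ℕ}
    {f g : ι → FreeLieAlgebra F κ}
    (hg : ∀ i, g i ∈ weightLE F e (d i)) (hfg : ∀ i, weightComp F e (d i) (g i) = f i)
    (h : Function.Injective (FreeLieAlgebra.lift F f)) :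
    Function.Injective (FreeLieAlgebra.lift F g) := by
  rw [injective_iff_map_eq_zero] at *
  intro a ha
  obtain ⟨N, hN⟩ := sum_weightComp d a
  have key : ∀ n, a = ∑ k ∈ Finset.range n, weightComp F d k a → a = 0 := by
    intro n
    induction n with
    | zero => simp
    | succ n ih =>
      intro hn
      apply ih
      rw [Finset.sum_range_succ] at hn
      -- The lower components of `a` contribute nothing in weight `n`, so a relation among the `g i`
      -- yields one among the `f i` for its top component.
      have h0 : weightComp F d n a = 0 := by
        apply h
        have h1 := congrArg (fun x => weightComp F e n (FreeLieAlgebra.lift F g x)) hn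
        simp only [ha, map_add, map_zero, map_sum,
          (lift_mem_weightLE hg hfg (weightComp_mem d n a)).2] at h1
        rw [Finset.sum_eq_zero, zero_add] at h1
        · exact h1.symm
        · intro k hk
          exact mem_weightLE.mp (lift_mem_weightLE hg hfg (weightComp_mem d k a)).1 _
            (Finset.mem_range.mp hk)
      rwa [h0, add_zero] at hn
  exact key N (hN N le_rfl)

end Weight

/-! ### The grading by degree in `X` -/

section Degree

variable {F : Type u} [Field F] {X : Type v}

/-- The weights for which all free generators have weight one. -/
abbrev degreeOne (X : Type v) : X → ℕ := fun _ => 1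

theorem homogeneousComponent_eq_weightSpace (n : ℕ) :
    homogeneousComponent F X n = weightSpace F (degreeOne X) n := by
  apply le_antisymm
  · rw [homogeneousComponent, Submodule.span_le]
    intro c hc
    induction hc with
    | of x => exact of_mem_weightSpace _ x
    | lie hc hd h h' => exact lie_mem_weightSpace h h'
  · intro a ha
    have key : ∀ n, weightComp F (degreeOne X) n a ∈ homogeneousComponent F X n := by
      clear ha
      induction a using freeLie_induction with
      | of x =>
        intro n
        rw [weightComp_of]
        split_ifs with h
        · subst h
          exact Submodule.subset_span (.of x)
        · exact zero_mem _
      | zero => simp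
      | add a b ha hb => intro n; rw [map_add]; exact add_mem (ha n) (hb n)
      | smul r a ha => intro n; rw [map_smul]; exact Submodule.smul_mem _ _ (ha n)
      | lie a b ha hb =>
        intro n
        rw [weightComp_lie]
        refine sum_mem fun ij hij => ?_
        obtain rfl := Finset.HasAntidiagonal.mem_antidiagonal.mp hij
        refine Submodule.span_induction₂ (p := fun x y _ _ =>
          ⁅x, y⁆ ∈ homogeneousComponent F X (ij.1 + ij.2)) ?_ ?_ ?_ ?_ ?_ ?_ ?_ (ha ij.1) (hb ij.2)
        · exact fun x y hx hy => Submodule.subset_span (.lie hx hy)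
        · simp
        · simp
        · intro x y z _ _ _ h h'; rw [add_lie]; exact add_mem h h'
        · intro x y z _ _ _ h h'; rw [lie_add]; exact add_mem h h'
        · intro r x y _ _ h; rw [smul_lie]; exact Submodule.smul_mem _ _ h
        · intro r x y _ _ h; rw [lie_smul]; exact Submodule.smul_mem _ _ h
    simpa [weightComp_of_mem ha] using key n

theorem isHomogeneousSubalgebra_iff (H : LieSubalgebra F (FreeLieAlgebra F X)) :
    IsHomogeneousSubalgebra H ↔ ∀ a ∈ H, ∀ n, weightComp F (degreeOne X) n a ∈ H := by
  simp only [IsHomogeneousSubalgebra, homogeneousComponent_eq_weightSpace]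
  constructor
  · intro h a ha n
    obtain ⟨N, hN⟩ := sum_weightComp (degreeOne X) a
    obtain ⟨M, hM⟩ := exists_mem_weightLE (degreeOne X) a
    rw [mem_weightLE] at hM
    -- The bound `N` makes the components sum to `a`; the bound `M + 1` ensures that none beyond the
    -- range is nonzero.
    let f : ℕ →₀ FreeLieAlgebra F X := Finsupp.onFinset (Finset.range (max N (M + 1)))
      (fun k => weightComp F (degreeOne X) k a) fun k hk => by
        by_contra hk'
        rw [Finset.mem_range, not_lt] at hk'
        exact hk (hM k (lt_of_lt_of_le (Nat.lt_succ_self M) ((le_max_right _ _).trans hk')))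
    refine h f (fun k => weightComp_mem _ _ _) ?_ n
    rw [Finsupp.onFinset_sum _ fun _ => rfl, ← hN _ (le_max_left _ _)]
    exact ha
  · intro h a ha hs n
    have := h _ hs n
    rw [Finsupp.sum, map_sum] at this
    simp only [weightComp_of_mem (ha _)] at this
    rw [Finset.sum_ite_eq] at this
    split_ifs at this with hn
    · exact this
    · rw [Finsupp.notMem_support_iff.mp hn]; exact zero_mem _

theorem isHomogeneousSubalgebra_lieSpan {S : Set (FreeLieAlgebra F X)}
    (hS : ∀ s ∈ S, ∃ n, s ∈ weightSpace F (degreeOne X) n) :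
    IsHomogeneousSubalgebra (LieSubalgebra.lieSpan F (FreeLieAlgebra F X) S) := by
  rw [isHomogeneousSubalgebra_iff]
  intro a ha
  induction ha using LieSubalgebra.lieSpan_induction with
  | mem a h =>
    intro n
    obtain ⟨m, hm⟩ := hS a h
    rw [weightComp_of_mem hm]
    split_ifs
    · exact LieSubalgebra.subset_lieSpan h
    · exact zero_mem _
  | zero => simp
  | add a b _ _ ha hb => intro n; rw [map_add]; exact add_mem (ha n) (hb n)
  | smul r a _ ha => intro n; rw [map_smul]; exact LieSubalgebra.smul_mem _ _ (ha n)
  | lie a b _ _ ha hb =>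
    intro n
    rw [weightComp_lie]
    exact sum_mem fun ij _ => LieSubalgebra.lie_mem _ (ha _) (hb _)

/-- Lengths are positive, so a bracket of length `n` has two strictly shorter factors. This is where
finiteness of `X` enters. -/
theorem finite_isCommutator [Finite X] (n : ℕ) : {c | IsCommutator F X n c}.Finite := by
  have pos : ∀ {k c}, IsCommutator F X k c → 0 < k := by
    intro k c h
    induction h with
    | of => exact one_pos
    | lie _ _ h _ => omega
  induction n using Nat.strong_induction_on with
  | _ n ih =>
    refine ((Set.finite_range (FreeLieAlgebra.of F (X := X))).union
      (Set.Finite.biUnion (Set.finite_lt_nat n) (t := fun k => ⋃ l ∈ {l | l < n},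
        Set.image2 (fun c d => ⁅c, d⁆) {c | IsCommutator F X k c} {c | IsCommutator F X l c})
        fun k hk => (Set.finite_lt_nat n).biUnion fun l hl => (ih k hk).image2 _ (ih l hl))).subset ?_
    rintro c hc
    cases hc with
    | of x => exact Or.inl ⟨x, rfl⟩
    | @lie k l c d hc hd =>
      have := pos hc
      have := pos hd
      refine Or.inr ?_
      simp only [Set.mem_iUnion]
      exact ⟨k, by simp; omega, l, by simp; omega, _, hc, _, hd, rfl⟩

theorem finiteDimensional_weightLE [Finite X] (n : ℕ) :
    FiniteDimensional F (weightLE F (degreeOne X) n) := by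
  have h : weightLE F (degreeOne X) n ≤
      (Finset.range (n + 1)).sup (weightSpace F (degreeOne X)) := by
    intro a ha
    rw [mem_weightLE] at ha
    obtain ⟨N, hN⟩ := sum_weightComp (degreeOne X) a
    rw [hN _ (le_max_left N (n + 1))]
    refine sum_mem fun k _ => ?_
    by_cases hk : k ∈ Finset.range (n + 1)
    · exact Finset.le_sup (f := weightSpace F (degreeOne X)) hk (weightComp_mem _ _ _)
    · rw [ha k (by simpa using hk)]
      exact zero_mem _
  have hfin (k : ℕ) : FiniteDimensional F (weightSpace F (degreeOne X) k) := by
    rw [← homogeneousComponent_eq_weightSpace]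
    exact FiniteDimensional.span_of_finite F (finite_isCommutator k)
  have : FiniteDimensional F
      ((Finset.range (n + 1)).sup (weightSpace F (degreeOne X)) : Submodule F _) :=
    Submodule.finiteDimensional_finset_sup _ _
  exact Submodule.finiteDimensional_of_le h

end Degree

/-! ### Independent families -/

section Families

variable {F : Type u} [Field F] {ι : Type v} {κ : Type z} {L : Type w} [LieRing L] [LieAlgebra F L]

theorem lift_injective_comp {v : ι → L} (hv : Function.Injective (FreeLieAlgebra.lift F v))
    {e : κ → ι} (he : Function.Injective e) :
    Function.Injective (FreeLieAlgebra.lift F (fun k => v (e k))) := by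
  let i : FreeLieAlgebra F κ →ₗ⁅F⁆ FreeLieAlgebra F ι :=
    FreeLieAlgebra.lift F fun k => FreeLieAlgebra.of F (e k)
  -- A retraction that kills the generators outside the image of `e`.
  let r : FreeLieAlgebra F ι →ₗ⁅F⁆ FreeLieAlgebra F κ :=
    FreeLieAlgebra.lift F (Function.extend e (FreeLieAlgebra.of F) 0)
  have hri : r.comp i = LieHom.id := by
    apply FreeLieAlgebra.hom_ext
    intro k
    simp [i, r, he.extend_apply]
  have hi : Function.Injective i := by
    intro a b hab
    rw [← LieHom.id_apply (R := F) a, ← LieHom.id_apply (R := F) b, ← hri, LieHom.comp_apply, hab,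
      LieHom.comp_apply]
  have h : FreeLieAlgebra.lift F (fun k => v (e k)) = (FreeLieAlgebra.lift F v).comp i := by
    simp [i, comp_lift]
  rw [h]
  exact hv.comp hi

theorem isFreeBasis_range {v : ι → L} (hv : Function.Injective (FreeLieAlgebra.lift F v)) :
    IsFreeBasis (F := F) (Set.range v) (LieSubalgebra.lieSpan F L (Set.range v)) := by
  refine ⟨?_, rfl⟩
  choose e he using fun s : Set.range v => s.2
  have h := lift_injective_comp hv (e := e) fun s t hst => by
    apply Subtype.ext
    rw [← he s, ← he t, hst]
  simpa only [he] using h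

theorem of_ne_zero (i : ι) : FreeLieAlgebra.of F i ≠ 0 := by
  -- `F` is taken as the one-dimensional Lie algebra, in which every generator can be sent to `1`.
  let _ : LieRing F := LieRing.ofAssociativeRing
  let _ : LieAlgebra F F := LieAlgebra.ofAssociativeAlgebra
  intro h
  have h1 := FreeLieAlgebra.lift_of_apply (R := F) (fun _ : ι => (1 : F)) i
  rw [h, map_zero] at h1
  exact zero_ne_one h1

theorem map_mem_lieSpan {v : ι → L} (s : Set ι) {a : FreeLieAlgebra F ι}
    (ha : a ∈ LieSubalgebra.lieSpan F (FreeLieAlgebra F ι) (FreeLieAlgebra.of F '' s)) :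
    FreeLieAlgebra.lift F v a ∈ LieSubalgebra.lieSpan F L (v '' s) := by
  have h := LieSubalgebra.map_lieSpan (FreeLieAlgebra.lift F v) (s := FreeLieAlgebra.of F '' s)
  rw [← Set.image_comp, FreeLieAlgebra.of_comp_lift] at h
  rw [← h]
  exact ⟨a, ha, rfl⟩

/-- Killing the generators in `s` annihilates the subalgebra they generate but fixes generator `i`.
It will show that the added basis elements lie outside `H`. -/
theorem notMem_lieSpan_image {v : ι → L} (hv : Function.Injective (FreeLieAlgebra.lift F v))
    {s : Set ι} {i : ι} (hi : i ∉ s) : v i ∉ LieSubalgebra.lieSpan F L (v '' s) := by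
  classical
  intro h
  have h' := LieSubalgebra.map_lieSpan (FreeLieAlgebra.lift F v) (s := FreeLieAlgebra.of F '' s)
  rw [← Set.image_comp, FreeLieAlgebra.of_comp_lift] at h'
  rw [← h'] at h
  obtain ⟨a, ha, hav⟩ := h
  have hai : a = FreeLieAlgebra.of F i := hv (hav.trans (FreeLieAlgebra.lift_of_apply v i).symm)
  subst hai
  let r : FreeLieAlgebra F ι →ₗ⁅F⁆ FreeLieAlgebra F ι :=
    FreeLieAlgebra.lift F fun j => if j ∈ s then 0 else FreeLieAlgebra.of F j
  have hr : ∀ b ∈ LieSubalgebra.lieSpan F (FreeLieAlgebra F ι) (FreeLieAlgebra.of F '' s),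
      r b = 0 := by
    intro b hb
    induction hb using LieSubalgebra.lieSpan_induction with
    | mem b hb =>
      obtain ⟨j, hj, rfl⟩ := hb
      simp [r, hj]
    | zero => simp
    | add a b _ _ ha hb => simp [ha, hb]
    | smul c a _ ha => simp [ha]
    | lie a b _ _ ha hb => simp [ha]
  have h0 := hr _ ha
  simp only [r, FreeLieAlgebra.lift_of_apply, if_neg hi] at h0
  exact of_ne_zero i h0

end Families

/-! ### Enlarging a homogeneous subalgebra to one with a homogeneous free basis -/

section Enlargement

variable {F : Type u} [Field F] {X : Type v}

theorem eliminate_homogeneous {Y : Set (FreeLieAlgebra F X)}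
    (hY : ∀ y ∈ Y, ∃ n, y ∈ weightSpace F (degreeOne X) n) {c : Y → F} {x : Y} {k : ℕ}
    (hc : ∀ y : Y, c y ≠ 0 → (y : FreeLieAlgebra F X) ∈ weightSpace F (degreeOne X) k)
    (hx : (x : FreeLieAlgebra F X) ∈ weightSpace F (degreeOne X) k) (p : ℕ × {y : Y // y ≠ x}) :
    ∃ n, eliminate (fun y : Y => (y : FreeLieAlgebra F X)) c x p ∈
      weightSpace F (degreeOne X) n := by
  obtain ⟨j, y⟩ := p
  induction j with
  | zero =>
    rw [eliminate_zero]
    by_cases h : c y = 0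
    · rw [h, zero_smul, sub_zero]
      exact hY _ y.1.2
    · exact ⟨k, sub_mem (hc _ h) (Submodule.smul_mem _ _ hx)⟩
  | succ j ih =>
    obtain ⟨n, hn⟩ := ih
    rw [eliminate_succ]
    exact ⟨k + n, lie_mem_weightSpace hx hn⟩

/-- `Y` is a homogeneous free basis of a subalgebra which contains `G` and all homogeneous
elements of degree greater than `N`. -/
structure IsEnlargementBasis (G : LieSubalgebra F (FreeLieAlgebra F X))
    (Y : Set (FreeLieAlgebra F X)) (N : ℕ) : Prop where
  free : Function.Injective (FreeLieAlgebra.lift F (fun y : Y => (y : FreeLieAlgebra F X)))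
  homogeneous : ∀ y ∈ Y, ∃ n, y ∈ weightSpace F (degreeOne X) n
  le : G ≤ LieSubalgebra.lieSpan F _ Y
  mem : ∀ k, N < k → ∀ a ∈ weightSpace F (degreeOne X) k, a ∈ LieSubalgebra.lieSpan F _ Y

/-- A homogeneous subalgebra `G` can be enlarged, without changing it in degrees at most `n`, to
a subalgebra which has a homogeneous free basis and contains all elements of large degree. -/
theorem exists_free_enlargement [Finite X] (G : LieSubalgebra F (FreeLieAlgebra F X))
    (hG : ∀ a ∈ G, ∀ n, weightComp F (degreeOne X) n a ∈ G) (n : ℕ) :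
    ∃ (Y : Set (FreeLieAlgebra F X)) (N : ℕ), IsEnlargementBasis G Y N ∧
      ∀ k ≤ n, ∀ a ∈ LieSubalgebra.lieSpan F _ Y,
        a ∈ weightSpace F (degreeOne X) k → a ∈ G := by
  classical
  have := finiteDimensional_weightLE (F := F) (X := X) n
  -- Descent from `M = L` by induction on the finite dimension of the part of `M` of degree at most
  -- `n`.
  suffices key : ∀ (m : ℕ) (Y : Set (FreeLieAlgebra F X)) (N : ℕ), IsEnlargementBasis G Y N →
      Module.finrank F ((LieSubalgebra.lieSpan F _ Y).toSubmodule ⊓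
        weightLE F (degreeOne X) n : Submodule F (FreeLieAlgebra F X)) = m →
      ∃ (Y : Set (FreeLieAlgebra F X)) (N : ℕ), IsEnlargementBasis G Y N ∧
        ∀ k ≤ n, ∀ a ∈ LieSubalgebra.lieSpan F _ Y,
          a ∈ weightSpace F (degreeOne X) k → a ∈ G by
    refine key _ (Set.range (FreeLieAlgebra.of F)) 0 ⟨(isFreeBasis_range ?_).1, ?_, ?_, ?_⟩ rfl
    · have h : FreeLieAlgebra.lift F (FreeLieAlgebra.of F (X := X)) = LieHom.id :=
        FreeLieAlgebra.hom_ext (by simp)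
      rw [h]
      exact Function.injective_id
    · rintro _ ⟨x, rfl⟩
      exact ⟨1, of_mem_weightSpace _ x⟩
    · rw [lieSpan_range_of]
      exact le_top
    · intro k _ a _
      rw [lieSpan_range_of]
      trivial
  intro m
  induction m using Nat.strong_induction_on with
  | _ m ih =>
  rintro Y N ⟨hfree, hhom, hGY, hN⟩ hm
  set M := LieSubalgebra.lieSpan F _ Y with hM
  by_cases hex : ∃ k, k ≤ n ∧ ∃ a ∈ M, a ∈ weightSpace F (degreeOne X) k ∧ a ∉ G
  swap
  · push Not at hex
    exact ⟨Y, N, ⟨hfree, hhom, hGY, hN⟩, hex⟩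
  obtain ⟨hkn, a, haM, hak, haG⟩ := Nat.find_spec hex
  have hmin : ∀ j < Nat.find hex, ∀ b ∈ M, b ∈ weightSpace F (degreeOne X) j → b ∈ G := by
    intro j hj b hb hbj
    by_contra hbG
    exact Nat.find_min hex hj ⟨hj.le.trans hkn, b, hb, hbj, hbG⟩
  set k := Nat.find hex
  have hMhom := (isHomogeneousSubalgebra_iff M).mp (isHomogeneousSubalgebra_lieSpan hhom)
  -- A functional vanishing on `p` depends only on the degree `k` component modulo `G`. Hence it
  -- kills `G` and every homogeneous element of another degree.
  let p : Submodule F (FreeLieAlgebra F X) := G.toSubmodule.comap (weightComp F (degreeOne X) k)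
  have hmemp : ∀ b, b ∈ p ↔ weightComp F (degreeOne X) k b ∈ G := fun _ => Iff.rfl
  have hap : a ∉ p := by
    rw [hmemp, weightComp_of_mem hak, if_pos rfl]
    exact haG
  obtain ⟨f, hfa, hfp⟩ := Submodule.exists_le_ker_of_notMem hap
  have hfp' : ∀ b, weightComp F (degreeOne X) k b ∈ G → f b = 0 := fun b hb => hfp hb
  -- The degree `k` part of a commutator is built from components of degree less than `k`, which lie
  -- in `G` by minimality of `k`.
  have hf : ∀ b ∈ M, ∀ c ∈ M, f ⁅b, c⁆ = 0 := by
    intro b hb c hc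
    apply hfp'
    rw [weightComp_lie]
    refine sum_mem fun ij hij => ?_
    rw [Finset.HasAntidiagonal.mem_antidiagonal] at hij
    rcases Nat.eq_zero_or_pos ij.1 with h | h
    · simp [h, weightComp_zero]
    rcases Nat.eq_zero_or_pos ij.2 with h' | h'
    · simp [h', weightComp_zero]
    exact LieSubalgebra.lie_mem _
      (hmin ij.1 (by omega) _ (hMhom b hb _) (weightComp_mem _ _ _))
      (hmin ij.2 (by omega) _ (hMhom c hc _) (weightComp_mem _ _ _))
  have hMr : LieSubalgebra.lieSpan F _ (Set.range fun y : Y => (y : FreeLieAlgebra F X)) = M := by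
    rw [Subtype.range_coe]
  obtain ⟨x, hx⟩ : ∃ x : Y, f x ≠ 0 := by
    by_contra hcon
    push Not at hcon
    suffices h : ∀ b ∈ LieSubalgebra.lieSpan F _ Y, f b = 0 from hfa (h a haM)
    intro b hb
    induction hb using LieSubalgebra.lieSpan_induction with
    | mem b hb => exact hcon ⟨b, hb⟩
    | zero => simp
    | add b c _ _ hb hc => simp [hb, hc]
    | smul r b _ hb => simp [hb]
    | lie b c hb hc _ _ => exact hf b hb c hc
  have hdeg : ∀ y : Y, f y ≠ 0 → (y : FreeLieAlgebra F X) ∈ weightSpace F (degreeOne X) k := by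
    intro y hy
    obtain ⟨j, hj⟩ := hhom y y.2
    obtain rfl : k = j := by
      by_contra hne
      apply hy
      apply hfp'
      rw [weightComp_of_mem hj, if_neg hne]
      exact zero_mem _
    exact hj
  let u := eliminate (fun y : Y => (y : FreeLieAlgebra F X)) (fun y => f y / f x) x
  have hmem : ∀ b, b ∈ LieSubalgebra.lieSpan F _ (Set.range u) ↔ b ∈ M ∧ f b = 0 := by
    intro b
    rw [← hMr]
    exact mem_lieSpan_eliminate_iff _ f x hx (by rwa [hMr]) b
  -- The new subalgebra is `M ∩ ker f`: it loses `a`, so the dimension drops, and in degrees above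
  -- `k` it loses nothing.
  refine ih _ ?_ (Set.range u) (max N k)
    ⟨(isFreeBasis_range (eliminate_injective hfree _ x)).1, ?_, ?_, ?_⟩ rfl
  · rw [← hm]
    have : FiniteDimensional F (M.toSubmodule ⊓ weightLE F (degreeOne X) n :
        Submodule F (FreeLieAlgebra F X)) := Submodule.finiteDimensional_of_le inf_le_right
    apply Submodule.finrank_lt_finrank_of_lt
    refine lt_of_le_of_ne ?_ ?_
    · exact fun b hb => ⟨((hmem b).mp hb.1).1, hb.2⟩
    · intro heq
      have ha : a ∈ M.toSubmodule ⊓ weightLE F (degreeOne X) n :=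
        ⟨haM, weightLE_mono _ hkn (weightSpace_le_weightLE _ _ hak)⟩
      rw [← heq] at ha
      exact hfa ((hmem a).mp ha.1).2
  · rintro _ ⟨q, rfl⟩
    exact eliminate_homogeneous hhom
      (fun y hy => hdeg y (fun h => hy (by rw [h, zero_div]))) (hdeg x hx) q
  · exact fun b hb => (hmem b).mpr ⟨hGY hb, hfp' b (hG b hb k)⟩
  · intro j hj b hb
    refine (hmem b).mpr ⟨hN j ((le_max_left _ _).trans_lt hj) b hb, hfp' b ?_⟩
    rw [weightComp_of_mem hb, if_neg ((le_max_right _ _).trans_lt hj).ne]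
    exact zero_mem _

end Enlargement

/-! ### Leading terms of `H` and the extension of a basis -/

section Leading

variable {F : Type u} [Field F] {X : Type v}

/-- The homogeneous subalgebra spanned by the leading terms of the elements of `H`. -/
def leadingSubalgebra (H : LieSubalgebra F (FreeLieAlgebra F X)) :
    LieSubalgebra F (FreeLieAlgebra F X) where
  carrier := {a | ∀ n, ∃ h ∈ H, h ∈ weightLE F (degreeOne X) n ∧
    weightComp F (degreeOne X) n h = weightComp F (degreeOne X) n a}
  zero_mem' := fun _ => ⟨0, zero_mem _, zero_mem _, rfl⟩
  add_mem' := by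
    intro a b ha hb n
    obtain ⟨h, h1, h2, h3⟩ := ha n
    obtain ⟨h', h1', h2', h3'⟩ := hb n
    exact ⟨h + h', add_mem h1 h1', add_mem h2 h2', by rw [map_add, map_add, h3, h3']⟩
  smul_mem' := by
    intro r a ha n
    obtain ⟨h, h1, h2, h3⟩ := ha n
    exact ⟨r • h, H.smul_mem r h1, Submodule.smul_mem _ r h2, by rw [map_smul, map_smul, h3]⟩
  lie_mem' := by
    intro a b ha hb n
    choose g g1 g2 g3 using ha
    choose h h1 h2 h3 using hb
    refine ⟨∑ ij ∈ Finset.HasAntidiagonal.antidiagonal n, ⁅g ij.1, h ij.2⁆,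
      sum_mem fun ij _ => LieSubalgebra.lie_mem _ (g1 _) (h1 _), sum_mem fun ij hij => ?_, ?_⟩
    · rw [← Finset.HasAntidiagonal.mem_antidiagonal.mp hij]
      exact (lie_mem_weightLE (g2 _) (h2 _)).1
    · rw [weightComp_lie, map_sum]
      refine Finset.sum_congr rfl fun ij hij => ?_
      rw [← g3, ← h3, ← (lie_mem_weightLE (g2 ij.1) (h2 ij.2)).2,
        Finset.HasAntidiagonal.mem_antidiagonal.mp hij]

theorem mem_leadingSubalgebra {H : LieSubalgebra F (FreeLieAlgebra F X)}
    {a : FreeLieAlgebra F X} : a ∈ leadingSubalgebra H ↔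
      ∀ n, ∃ h ∈ H, h ∈ weightLE F (degreeOne X) n ∧
        weightComp F (degreeOne X) n h = weightComp F (degreeOne X) n a := Iff.rfl

theorem weightComp_mem_leadingSubalgebra {H : LieSubalgebra F (FreeLieAlgebra F X)}
    {n : ℕ} {a h : FreeLieAlgebra F X} (hh : h ∈ H) (hn : h ∈ weightLE F (degreeOne X) n)
    (ha : weightComp F (degreeOne X) n h = weightComp F (degreeOne X) n a) :
    weightComp F (degreeOne X) n a ∈ leadingSubalgebra H := by
  rw [mem_leadingSubalgebra]
  intro m
  rw [weightComp_weightComp]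
  split_ifs with hm
  · subst hm
    exact ⟨h, hh, hn, ha⟩
  · exact ⟨0, zero_mem _, zero_mem _, map_zero _⟩

theorem leadingSubalgebra_homogeneous (H : LieSubalgebra F (FreeLieAlgebra F X)) :
    ∀ a ∈ leadingSubalgebra H, ∀ n, weightComp F (degreeOne X) n a ∈ leadingSubalgebra H := by
  intro a ha n
  obtain ⟨h, h1, h2, h3⟩ := ha n
  exact weightComp_mem_leadingSubalgebra h1 h2 h3

/-- The lift respects the gradings, so any preimage may be replaced by its component of weight `k`.
-/
theorem exists_weight_preimage {ι : Type w} {d : ι → ℕ} {f : ι → FreeLieAlgebra F X}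
    (hf : ∀ i, f i ∈ weightSpace F (degreeOne X) (d i)) {k : ℕ} {b : FreeLieAlgebra F X}
    (hb : b ∈ LieSubalgebra.lieSpan F _ (Set.range f)) (hbk : b ∈ weightSpace F (degreeOne X) k) :
    ∃ a ∈ weightSpace F d k, FreeLieAlgebra.lift F f a = b := by
  obtain ⟨a, rfl⟩ := (mem_lieSpan_range_iff f b).mp hb
  refine ⟨weightComp F d k a, weightComp_mem _ _ _, ?_⟩
  rw [← weightComp_lift hf, weightComp_of_mem hbk, if_pos rfl]

/-- A finitely generated subalgebra `H` has a free basis which is part of a free basis of a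
subalgebra of finite codimension, the other members of which are homogeneous. -/
theorem exists_basis_extension [Finite X] (H : LieSubalgebra F (FreeLieAlgebra F X))
    (hH : IsFinitelyGenerated H) :
    ∃ (ι : Type (max u v)) (g : ι → FreeLieAlgebra F X) (T : Set ι),
      Function.Injective (FreeLieAlgebra.lift F g) ∧
      LieSubalgebra.lieSpan F _ (g '' Tᶜ) = H ∧
      (∀ i ∈ T, ∃ n, g i ∈ weightSpace F (degreeOne X) n) ∧
      FiniteDimensional F
        (FreeLieAlgebra F X ⧸ (LieSubalgebra.lieSpan F _ (Set.range g)).toSubmodule) ∧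
      (IsHomogeneousSubalgebra H → ∃ N, ∀ k, N < k → ∀ a ∈ weightSpace F (degreeOne X) k,
        a ∈ LieSubalgebra.lieSpan F _ (Set.range g)) := by
  obtain ⟨S, hSfin, hSH⟩ := hH
  obtain ⟨n, hn⟩ : ∃ n, ∀ s ∈ S, s ∈ weightLE F (degreeOne X) n := by
    choose m hm using exists_mem_weightLE (F := F) (degreeOne X)
    obtain ⟨n, hn⟩ := (hSfin.image m).bddAbove
    exact ⟨n, fun s hs => weightLE_mono _ (hn ⟨s, hs, rfl⟩) (hm s)⟩
  obtain ⟨Y, N, ⟨hfree, hhom, hGY, hN⟩, hYG⟩ := exists_free_enlargement (leadingSubalgebra H)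
    (leadingSubalgebra_homogeneous H) n
  choose d hd using fun y : Y => hhom y y.2
  have hYr : Set.range (fun y : Y => (y : FreeLieAlgebra F X)) = Y := Subtype.range_coe
  -- In degree at most `n`, `y` lies in the leading subalgebra and so is the leading term of some `b
  -- ∈ H`. If `H` is homogeneous, `y` itself lies in `H` and nothing needs replacing.
  have hex : ∀ y : Y, ∃ b, b ∈ weightLE F (degreeOne X) (d y) ∧
      weightComp F (degreeOne X) (d y) b = y ∧ (d y ≤ n → b ∈ H) ∧ (n < d y → b = y) ∧
      (IsHomogeneousSubalgebra H → b = y) := by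
    intro y
    have hy1 := weightSpace_le_weightLE _ _ (hd y)
    have hy2 : weightComp F (degreeOne X) (d y) (y : FreeLieAlgebra F X) = y := by
      rw [weightComp_of_mem (hd y), if_pos rfl]
    rcases lt_or_ge n (d y) with h | h
    · exact ⟨y, hy1, hy2, fun h' => absurd h h'.not_gt, fun _ => rfl, fun _ => rfl⟩
    · obtain ⟨b, hb1, hb2, hb3⟩ :=
        hYG _ h _ (LieSubalgebra.subset_lieSpan y.2) (hd y) (d y)
      rw [hy2] at hb3
      by_cases hHh : IsHomogeneousSubalgebra H
      · refine ⟨y, hy1, hy2, fun _ => ?_, fun _ => rfl, fun _ => rfl⟩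
        rw [← hb3]
        exact (isHomogeneousSubalgebra_iff H).mp hHh b hb1 _
      · exact ⟨b, hb2, hb3, fun _ => hb1, fun h' => absurd h' h.not_gt, fun h' => absurd h' hHh⟩
  choose g hg1 hg2 hg3 hg4 hg5 using hex
  have hcompl : {y : Y | n < d y}ᶜ = {y | d y ≤ n} := by ext; simp
  refine ⟨Y, g, {y | n < d y}, lift_injective_of_leading hg1 hg2 hfree, ?_, ?_, ?_, ?_⟩
  · rw [hcompl]
    have hle : LieSubalgebra.lieSpan F _ (g '' {y | d y ≤ n}) ≤ H := by
      rw [LieSubalgebra.lieSpan_le]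
      rintro _ ⟨y, hy, rfl⟩
      exact hg3 y hy
    refine le_antisymm hle ?_
    -- The leading term of `h` is an expression in those `y` of degree at most `n`. The same
    -- expression in the `g y` lies in `H` and has the same leading term; subtracting it lowers the
    -- degree.
    have key : ∀ k ≤ n, ∀ h ∈ H, h ∈ weightLE F (degreeOne X) k →
        h ∈ LieSubalgebra.lieSpan F _ (g '' {y | d y ≤ n}) := by
      intro k
      induction k with
      | zero =>
        intro _ h _ h0
        rw [eq_zero_of_mem_weightLE_zero h0 (weightComp_zero (fun _ => one_pos) h)]
        exact zero_mem _
      | succ k ih =>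
        intro hk h hh hhk
        obtain ⟨a, ha, hah⟩ := exists_weight_preimage hd
          (by rw [hYr]; exact hGY (weightComp_mem_leadingSubalgebra hh hhk rfl))
          (weightComp_mem _ (k + 1) h)
        obtain ⟨h1, h2⟩ := lift_mem_weightLE hg1 hg2 ha
        have h3 := map_mem_lieSpan (v := g) _ (weightSpace_le_lieSpan d hk ha)
        rw [← sub_add_cancel h (FreeLieAlgebra.lift F g a)]
        refine add_mem (ih (Nat.le_of_succ_le hk) _ (sub_mem hh (hle h3)) ?_) h3
        refine weightLE_pred (sub_mem hhk h1) ?_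
        rw [map_sub, h2, hah, sub_self]
    rw [← hSH, LieSubalgebra.lieSpan_le]
    exact fun s hs => key n le_rfl s (hSH ▸ LieSubalgebra.subset_lieSpan hs) (hn s hs)
  · intro y hy
    rw [hg4 y hy]
    exact ⟨_, hd y⟩
  -- The same reduction works on all of `L` down to degree `N`, since `Y` generates everything
  -- above. What is left over is finite-dimensional.
  · have key : ∀ k, ∀ b ∈ weightLE F (degreeOne X) k,
        b ∈ (LieSubalgebra.lieSpan F _ (Set.range g)).toSubmodule ⊔
          weightLE F (degreeOne X) N := by
      intro k
      induction k with
      | zero =>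
        exact fun b hb => Submodule.mem_sup_right (weightLE_mono _ (Nat.zero_le N) hb)
      | succ k ih =>
        intro b hb
        rcases le_or_gt (k + 1) N with hkN | hkN
        · exact Submodule.mem_sup_right (weightLE_mono _ hkN hb)
        obtain ⟨a, ha, hab⟩ := exists_weight_preimage hd
          (by rw [hYr]; exact hN _ hkN _ (weightComp_mem _ _ b)) (weightComp_mem _ (k + 1) b)
        obtain ⟨h1, h2⟩ := lift_mem_weightLE hg1 hg2 ha
        rw [← sub_add_cancel b (FreeLieAlgebra.lift F g a)]
        refine add_mem (ih _ (weightLE_pred (sub_mem hb h1) ?_))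
          (Submodule.mem_sup_left ((mem_lieSpan_range_iff g _).mpr ⟨a, rfl⟩))
        rw [map_sub, h2, hab, sub_self]
    have := finiteDimensional_weightLE (F := F) (X := X) N
    refine Module.Finite.of_surjective
      ((LieSubalgebra.lieSpan F _ (Set.range g)).toSubmodule.mkQ ∘ₗ
        (weightLE F (degreeOne X) N).subtype) ?_
    intro q
    obtain ⟨b, rfl⟩ := Submodule.mkQ_surjective _ q
    obtain ⟨k, hk⟩ := exists_mem_weightLE (degreeOne X) b
    obtain ⟨c, hc, e, he, rfl⟩ := Submodule.mem_sup.mp (key k b hk)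
    refine ⟨⟨e, he⟩, ?_⟩
    rw [map_add, Submodule.mkQ_apply _ c, (Submodule.Quotient.mk_eq_zero _).mpr hc, zero_add]
    rfl
  · intro hHh
    have : g = fun y : Y => (y : FreeLieAlgebra F X) := funext fun y => hg5 y hHh
    rw [this, hYr]
    exact ⟨N, hN⟩

end Leading

/-! ### Free products and joint free bases -/

section Coproduct

variable {F : Type u} [Field F] {L : Type v} [LieRing L] [LieAlgebra F L]

/-- The homomorphism `H ∗ K → L` which restricts to the inclusions on `H` and on `K`. -/
def freeProductMap (H K : LieSubalgebra F L) : FreeProduct F H K →ₗ⁅F⁆ L :=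
  (FreeProduct.existsUnique_lift H.incl K.incl).choose

theorem freeProductMap_comp_inl (H K : LieSubalgebra F L) :
    (freeProductMap H K).comp (FreeProduct.inl F H K) = H.incl :=
  (FreeProduct.existsUnique_lift H.incl K.incl).choose_spec.1.1

theorem freeProductMap_comp_inr (H K : LieSubalgebra F L) :
    (freeProductMap H K).comp (FreeProduct.inr F H K) = K.incl :=
  (FreeProduct.existsUnique_lift H.incl K.incl).choose_spec.1.2

@[simp]
theorem freeProductMap_inl (H K : LieSubalgebra F L) (h : H) :
    freeProductMap H K (FreeProduct.inl F H K h) = h :=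
  LieHom.congr_fun (freeProductMap_comp_inl H K) h

@[simp]
theorem freeProductMap_inr (H K : LieSubalgebra F L) (k : K) :
    freeProductMap H K (FreeProduct.inr F H K k) = k :=
  LieHom.congr_fun (freeProductMap_comp_inr H K) k

variable {ι : Type w} {κ : Type z} {H K : LieSubalgebra F L}

/-- The homomorphism from a free Lie algebra to `H ∗ K` given by families in `H` and in `K`. -/
def freeProductLift (f : ι → H) (g : κ → K) :
    FreeLieAlgebra F (ι ⊕ κ) →ₗ⁅F⁆ FreeProduct F H K :=
  FreeLieAlgebra.lift F
    (Sum.elim (fun i => FreeProduct.inl F H K (f i)) fun k => FreeProduct.inr F H K (g k))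

theorem freeProductMap_comp_lift (f : ι → H) (g : κ → K) :
    (freeProductMap H K).comp (freeProductLift f g) =
      FreeLieAlgebra.lift F (Sum.elim (fun i => (f i : L)) fun k => (g k : L)) := by
  apply FreeLieAlgebra.hom_ext
  rintro (i | k) <;> simp [freeProductLift]

theorem lift_surjective_of_lieSpan {f : ι → H}
    (hf : LieSubalgebra.lieSpan F L (Set.range fun i => (f i : L)) = H) :
    Function.Surjective (FreeLieAlgebra.lift F f) := by
  intro h
  have hh : (h : L) ∈ LieSubalgebra.lieSpan F L (Set.range fun i => (f i : L)) := by
    rw [hf]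
    exact h.2
  obtain ⟨a, ha⟩ := (mem_lieSpan_range_iff (fun i => (f i : L)) (h : L)).mp hh
  refine ⟨a, Subtype.ext ?_⟩
  rw [← ha]
  exact LieHom.congr_fun (comp_lift H.incl f) a

theorem freeProductLift_surjective {f : ι → H} {g : κ → K}
    (hf : LieSubalgebra.lieSpan F L (Set.range fun i => (f i : L)) = H)
    (hg : LieSubalgebra.lieSpan F L (Set.range fun k => (g k : L)) = K) :
    Function.Surjective (freeProductLift f g) := by
  intro x
  rw [← LieHom.mem_range]
  obtain ⟨x, rfl⟩ := Submodule.Quotient.mk_surjective _ x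
  let q : FreeLieAlgebra F (H ⊕ K) →ₗ⁅F⁆ FreeProduct F H K :=
    { toFun := LieSubmodule.Quotient.mk
      map_add' := fun _ _ => rfl
      map_smul' := fun _ _ => rfl
      map_lie' := rfl }
  change q x ∈ _
  induction x using freeLie_induction with
  | of s =>
    rcases s with h | k
    · obtain ⟨a, rfl⟩ := lift_surjective_of_lieSpan hf h
      refine ⟨FreeLieAlgebra.lift F (fun i => FreeLieAlgebra.of F (Sum.inl i)) a, ?_⟩
      have := (comp_lift (freeProductLift f g)
        fun i => FreeLieAlgebra.of F (Sum.inl i)).trans ((comp_lift (FreeProduct.inl F H K) f).trans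
          (by simp [freeProductLift])).symm
      exact LieHom.congr_fun this a
    · obtain ⟨a, rfl⟩ := lift_surjective_of_lieSpan hg k
      refine ⟨FreeLieAlgebra.lift F (fun i => FreeLieAlgebra.of F (Sum.inr i)) a, ?_⟩
      have := (comp_lift (freeProductLift f g)
        fun i => FreeLieAlgebra.of F (Sum.inr i)).trans ((comp_lift (FreeProduct.inr F H K) g).trans
          (by simp [freeProductLift])).symm
      exact LieHom.congr_fun this a
  | zero => rw [map_zero]; exact zero_mem _
  | add a b ha hb => rw [map_add]; exact add_mem ha hb
  | smul r a ha => rw [map_smul]; exact LieSubalgebra.smul_mem _ r ha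
  | lie a b ha hb => rw [LieHom.map_lie]; exact LieSubalgebra.lie_mem _ ha hb

/-- The free algebra on both families surjects onto `H ∗ K`, so injectivity of the composite to `L`
passes to the second factor. -/
theorem freeProductMap_injective {f : ι → H} {g : κ → K}
    (hf : LieSubalgebra.lieSpan F L (Set.range fun i => (f i : L)) = H)
    (hg : LieSubalgebra.lieSpan F L (Set.range fun k => (g k : L)) = K)
    (hfg : Function.Injective
      (FreeLieAlgebra.lift F (Sum.elim (fun i => (f i : L)) fun k => (g k : L)))) :
    Function.Injective (freeProductMap H K) := by
  rw [← freeProductMap_comp_lift] at hfg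
  intro x y hxy
  obtain ⟨a, rfl⟩ := freeProductLift_surjective hf hg x
  obtain ⟨b, rfl⟩ := freeProductLift_surjective hf hg y
  exact congrArg _ (hfg hxy)

theorem range_freeProductMap {f : ι → H} {g : κ → K}
    (hf : LieSubalgebra.lieSpan F L (Set.range fun i => (f i : L)) = H)
    (hg : LieSubalgebra.lieSpan F L (Set.range fun k => (g k : L)) = K) :
    (freeProductMap H K).range = LieSubalgebra.lieSpan F L
      (Set.range (Sum.elim (fun i => (f i : L)) fun k => (g k : L))) := by
  rw [← range_lift, ← freeProductMap_comp_lift]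
  ext x
  simp only [LieHom.mem_range]
  constructor
  · rintro ⟨y, rfl⟩
    obtain ⟨a, rfl⟩ := freeProductLift_surjective hf hg y
    exact ⟨a, rfl⟩
  · rintro ⟨a, rfl⟩
    exact ⟨_, rfl⟩

theorem lift_bijective {f : ι → H}
    (hf : LieSubalgebra.lieSpan F L (Set.range fun i => (f i : L)) = H)
    (hf' : Function.Injective (FreeLieAlgebra.lift F fun i => (f i : L))) :
    Function.Bijective (FreeLieAlgebra.lift F f) := by
  refine ⟨fun a b hab => hf' ?_, lift_surjective_of_lieSpan hf⟩
  have h := comp_lift H.incl f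
  change _ = FreeLieAlgebra.lift F fun i => (f i : L) at h
  rw [← h, LieHom.comp_apply, LieHom.comp_apply, hab]

/-- A converse to `freeProductMap_injective`, used to change the basis of `H`. When `f` and `g` are
free bases, inverting their lifts yields a left inverse `Ψ` of `freeProductLift f g`. -/
theorem lift_sumElim_injective {f : ι → H} {g : κ → K}
    (hf : LieSubalgebra.lieSpan F L (Set.range fun i => (f i : L)) = H)
    (hf' : Function.Injective (FreeLieAlgebra.lift F fun i => (f i : L)))
    (hg : LieSubalgebra.lieSpan F L (Set.range fun k => (g k : L)) = K)
    (hg' : Function.Injective (FreeLieAlgebra.lift F fun k => (g k : L)))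
    (hHK : Function.Injective (freeProductMap H K)) :
    Function.Injective
      (FreeLieAlgebra.lift F (Sum.elim (fun i => (f i : L)) fun k => (g k : L))) := by
  rw [← freeProductMap_comp_lift]
  let eH := LieEquiv.ofBijective _ (lift_bijective hf hf')
  let eK := LieEquiv.ofBijective _ (lift_bijective hg hg')
  obtain ⟨Ψ, ⟨h1, h2⟩, -⟩ := FreeProduct.existsUnique_lift
    ((FreeLieAlgebra.lift F fun i => FreeLieAlgebra.of F (Sum.inl i : ι ⊕ κ)).comp
      eH.symm.toLieHom)
    ((FreeLieAlgebra.lift F fun k => FreeLieAlgebra.of F (Sum.inr k : ι ⊕ κ)).comp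
      eK.symm.toLieHom)
  have heH (i : ι) : eH.symm (f i) = FreeLieAlgebra.of F i :=
    eH.symm_apply_eq.mpr (FreeLieAlgebra.lift_of_apply f i).symm
  have heK (k : κ) : eK.symm (g k) = FreeLieAlgebra.of F k :=
    eK.symm_apply_eq.mpr (FreeLieAlgebra.lift_of_apply g k).symm
  have h : Ψ.comp (freeProductLift f g) = LieHom.id := by
    apply FreeLieAlgebra.hom_ext
    rintro (i | k)
    · have := LieHom.congr_fun h1 (f i)
      simpa [freeProductLift, heH] using this
    · have := LieHom.congr_fun h2 (g k)
      simpa [freeProductLift, heK] using this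
  intro a b hab
  have hab' : freeProductLift f g a = freeProductLift f g b := hHK hab
  rw [← LieHom.id_apply (R := F) a, ← LieHom.id_apply (R := F) b, ← h, LieHom.comp_apply, hab',
    LieHom.comp_apply]

theorem exists_freeProduct_equiv {C : LieSubalgebra F L}
    (hHK : Function.Injective (freeProductMap H K)) (hC : (freeProductMap H K).range = C) :
    ∃ e : FreeProduct F H K ≃ₗ⁅F⁆ C,
      (∀ h : H, (e (FreeProduct.inl F H K h) : L) = h) ∧
      (∀ k : K, (e (FreeProduct.inr F H K k) : L) = k) := by
  subst hC
  refine ⟨LieEquiv.ofInjective _ hHK, fun h => ?_, fun k => ?_⟩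
  · rw [LieEquiv.ofInjective_apply, freeProductMap_inl]
  · rw [LieEquiv.ofInjective_apply, freeProductMap_inr]

end Coproduct

/-! ### Lower central series and degree -/

section LowerCentralSeries

variable {F : Type u} [Field F] {X : Type v}

/-- Indexing starts at `0` with the whole algebra, so index `t` is the term `L^(t+1)`, which lives
in degrees at least `t + 1`. -/
theorem weightComp_lowerCentralSeries (t : ℕ) : ∀ a ∈ LieModule.lowerCentralSeries F
    (FreeLieAlgebra F X) (FreeLieAlgebra F X) t, ∀ k ≤ t, weightComp F (degreeOne X) k a = 0 := by
  induction t with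
  | zero =>
    intro a _ k hk
    rw [Nat.le_zero.mp hk]
    exact weightComp_zero (fun _ => one_pos) a
  | succ t ih =>
    intro a ha k hk
    rw [LieModule.lowerCentralSeries_succ, ← LieSubmodule.mem_toSubmodule,
      LieSubmodule.lieIdeal_oper_eq_linear_span'] at ha
    induction ha using Submodule.span_induction with
    | mem a h =>
      obtain ⟨b, -, c, hc, rfl⟩ := h
      rw [weightComp_lie]
      refine Finset.sum_eq_zero fun ij hij => ?_
      rw [Finset.HasAntidiagonal.mem_antidiagonal] at hij
      rcases Nat.eq_zero_or_pos ij.1 with h | h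
      · rw [h, weightComp_zero (fun _ => one_pos), zero_lie]
      · rw [ih c hc ij.2 (by omega), lie_zero]
    | zero => simp
    | add a b _ _ ha hb => simp [ha, hb]
    | smul r a _ ha => simp [ha]

theorem lowerCentralSeries_le {C : LieSubalgebra F (FreeLieAlgebra F X)} {N : ℕ}
    (hC : ∀ k, N < k → ∀ a ∈ weightSpace F (degreeOne X) k, a ∈ C) :
    (LieModule.lowerCentralSeries F (FreeLieAlgebra F X) (FreeLieAlgebra F X) N).toSubmodule ≤
      C.toSubmodule := by
  intro a ha
  obtain ⟨n, hn⟩ := sum_weightComp (degreeOne X) a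
  rw [hn n le_rfl]
  refine sum_mem fun k _ => ?_
  rcases le_or_gt k N with h | h
  · rw [weightComp_lowerCentralSeries N a ha k h]
    exact zero_mem _
  · exact hC k h _ (weightComp_mem _ _ _)

end LowerCentralSeries

end FreeLie

end

/-! ### The main theorem -/

theorem theorem4 {F : Type*} [Field F] {X : Type*} [Finite X]
    (H : LieSubalgebra F (FreeLieAlgebra F X)) (hH : FreeLie.IsFinitelyGenerated H) :
    (∃ B₀ : Set (FreeLieAlgebra F X), FreeLie.IsFreeBasis B₀ H) ∧
    ∀ B₀ : Set (FreeLieAlgebra F X), FreeLie.IsFreeBasis B₀ H →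
      ∃ (B : Set (FreeLieAlgebra F X)) (C K : LieSubalgebra F (FreeLieAlgebra F X)),
        B₀ ⊆ B ∧
        FreeLie.IsFreeBasis B C ∧
        FiniteDimensional F (FreeLieAlgebra F X ⧸ C.toSubmodule) ∧
        K = LieSubalgebra.lieSpan F (FreeLieAlgebra F X) (B \ B₀) ∧
        (∃ e : FreeLie.FreeProduct F H K ≃ₗ⁅F⁆ C,
          (∀ h : H, (e (FreeLie.FreeProduct.inl F H K h) : FreeLieAlgebra F X) = h) ∧
          (∀ k : K, (e (FreeLie.FreeProduct.inr F H K k) : FreeLieAlgebra F X) = k)) ∧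
        FreeLie.IsHomogeneousSet (B \ B₀) ∧
        FreeLie.IsHomogeneousSubalgebra K ∧
        (FreeLie.IsHomogeneousSubalgebra H →
          ∃ t : ℕ, (LieModule.lowerCentralSeries F (FreeLieAlgebra F X)
            (FreeLieAlgebra F X) t).toSubmodule ≤ C.toSubmodule) := by
  classical
  obtain ⟨ι, g, T, hfree, hgH, hT, hfin, hlcs⟩ := FreeLie.exists_basis_extension H hH
  constructor
  · refine ⟨g '' Tᶜ, ?_⟩
    have h := FreeLie.isFreeBasis_range (FreeLie.lift_injective_comp hfree
      (e := ((↑) : (Tᶜ : Set ι) → ι)) Subtype.val_injective)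
    rwa [← Set.image_eq_range, hgH] at h
  rintro B₀ ⟨hB₀, hB₀H⟩
  let K := LieSubalgebra.lieSpan F (FreeLieAlgebra F X) (g '' T)
  -- No element of `g '' T` lies in `H`, by independence of `g`, hence none lies in `B₀`.
  have hdisj : (B₀ ∪ g '' T) \ B₀ = g '' T := by
    rw [Set.union_sdiff_left, sdiff_eq_left, Set.disjoint_left]
    rintro _ ⟨i, hi, rfl⟩ hiB
    refine FreeLie.notMem_lieSpan_image hfree (s := Tᶜ) (i := i) (by simpa using hi) ?_
    rw [hgH, ← hB₀H]
    exact LieSubalgebra.subset_lieSpan hiB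
  have hhom : ∀ s ∈ g '' T, ∃ n, s ∈ FreeLie.weightSpace F (FreeLie.degreeOne X) n := by
    rintro _ ⟨i, hi, rfl⟩
    exact hT i hi
  let f₁ : (Tᶜ : Set ι) → H := fun i =>
    ⟨g i, hgH ▸ LieSubalgebra.subset_lieSpan (Set.mem_image_of_mem g i.2)⟩
  let f₂ : T → K := fun i => ⟨g i, LieSubalgebra.subset_lieSpan (Set.mem_image_of_mem g i.2)⟩
  have hf₁ : LieSubalgebra.lieSpan F _ (Set.range fun i => (f₁ i : FreeLieAlgebra F X)) = H := by
    simpa only [Set.image_eq_range] using hgH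
  have hf₂ : LieSubalgebra.lieSpan F _ (Set.range fun i => (f₂ i : FreeLieAlgebra F X)) = K := by
    simp only [K, Set.image_eq_range, f₂]
  let σ : (Tᶜ : Set ι) ⊕ T ≃ ι := (Equiv.sumComm _ _).trans (Equiv.Set.sumCompl T)
  have hσ : (Sum.elim (fun i => (f₁ i : FreeLieAlgebra F X)) fun i => (f₂ i : _)) =
      fun s => g (σ s) := by
    ext (i | i) <;> simp [f₁, f₂, σ]
  -- Proved with the basis `g '' Tᶜ` of `H`; the conclusion no longer refers to it, so it transfers
  -- to `B₀` in `hbasis`.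
  have hinj : Function.Injective (FreeLie.freeProductMap H K) := by
    refine FreeLie.freeProductMap_injective hf₁ hf₂ ?_
    rw [hσ]
    exact FreeLie.lift_injective_comp hfree σ.injective
  have hrange : (FreeLie.freeProductMap H K).range = LieSubalgebra.lieSpan F _ (Set.range g) := by
    rw [FreeLie.range_freeProductMap hf₁ hf₂, hσ]
    congr 1
    exact σ.surjective.range_comp g
  let b : B₀ → H := fun s => ⟨s, hB₀H ▸ LieSubalgebra.subset_lieSpan s.2⟩
  have hb : LieSubalgebra.lieSpan F _ (Set.range fun i => (b i : FreeLieAlgebra F X)) = H := by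
    simpa only [b, Subtype.range_coe] using hB₀H
  have hunion : Set.range (Sum.elim (fun i => (b i : FreeLieAlgebra F X))
      fun i => (f₂ i : FreeLieAlgebra F X)) = B₀ ∪ g '' T := by
    rw [Set.Sum.elim_range, Set.image_eq_range]
    simp [b, f₂]
  have hbasis := FreeLie.isFreeBasis_range (FreeLie.lift_sumElim_injective hb hB₀ hf₂
    (FreeLie.lift_injective_comp hfree Subtype.val_injective) hinj)
  rw [← FreeLie.range_freeProductMap hb hf₂, hunion, hrange] at hbasis
  refine ⟨B₀ ∪ g '' T, LieSubalgebra.lieSpan F _ (Set.range g), K, Set.subset_union_left, hbasis,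
    hfin, by rw [hdisj], FreeLie.exists_freeProduct_equiv hinj hrange, ?_,
    FreeLie.isHomogeneousSubalgebra_lieSpan hhom, ?_⟩
  · rw [hdisj]
    simpa only [FreeLie.IsHomogeneousSet, FreeLie.homogeneousComponent_eq_weightSpace] using hhom
  · intro hHh
    obtain ⟨N, hN⟩ := hlcs hHh
    exact ⟨N, FreeLie.lowerCentralSeries_le hN⟩
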